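/- Let $p,q,r,s$ be integers with $p>1$, $q\ge 1$, $2\le r\le p$ and $s\ne 0$. The twisted torus link $T(p,q,r,s)$ is the closure of the $p$-strand braid $(\sigma_1\sigma_2\cdots\sigma_{p-1})^{q}(\sigma_1\sigma_2\cdots\sigma_{r-1})^{sr}$, that is, it is obtained from the $(p,q)$-torus link by $s$ full twists on $r$ adjacent strands; the same formula is used for the degenerate parameters $p=1$ or $r=1$ (for $r=1$ the twist is trivial and $T(p,q,1,s)$ is the torus link $T(p,q)$). For two components of a closed braid, oriented along the braid, the linking number is half of the signed number of crossings between strands of the two components. The link $T(p,q,r,s)$ has exactly two components if and only if $\gcd(p,q)=2$. Suppose that this is the case and that the linking number of the two components is zero. Then: 1. If $r$ is even, then $pq=-r^{2}s$, and each of the two components is isotopic to the twisted torus knot $T(p/2,q/2,r/2,s)$. 2. If $r=2r'+1$ is odd, then $pq=-4r'(r'+1)s$, and one of the components is isotopic to the twisted torus knot $T(p/2,q/2,r',s)$ and the other one to $T(p/2,q/2,r'+1,s)$. -/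

import Mathlib

open scoped ContDiff

noncomputable section

namespace TwistedTorus

/-- Euclidean three-space. -/
abbrev E3 := EuclideanSpace ℝ (Fin 3)

/-! ### Knots and isotopy -/

/-- A smooth `1`-periodic parametrization of a knot, that is, a smooth embedding of the
circle `ℝ / ℤ` into three-space. -/
structure IsKnotParam (γ : ℝ → E3) : Prop where
  smooth : ContDiff ℝ ∞ γ
  periodic : Function.Periodic γ 1
  immersion : ∀ u, deriv γ u ≠ 0
  injective : Set.InjOn γ (Set.Ico 0 1)

/-- Two subsets of three-space are isotopic (unoriented) knots: there is a smooth family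
`F (t, ·)`, `t ∈ [0,1]`, of smooth embeddings of the circle whose image is `K` at time `0`
and `K'` at time `1`. In particular both sets are smooth knots. (By isotopy extension this
is the same as smooth ambient isotopy.) -/
def KnotIsotopic (K K' : Set E3) : Prop :=
  ∃ F : ℝ × ℝ → E3, ContDiff ℝ ∞ F ∧
    (∀ t ∈ Set.Icc (0 : ℝ) 1, IsKnotParam (fun u => F (t, u))) ∧
    Set.range (fun u => F (0, u)) = K ∧ Set.range (fun u => F (1, u)) = K'

/-! ### Braid words and their closures

Strand positions are numbered `0, 1, 2, …`. The letter `(i, 1)` is the generator that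
crosses the strands at positions `i` and `i + 1` positively, `(i, -1)` is its inverse. A
word is read from left to right. -/

/-- Words in the braid generators and their inverses. -/
abbrev BraidWord := List (ℕ × ℤˣ)

/-- The permutation of a braid word: `perm w j` is the final position of the strand that
starts at position `j`. -/
def perm : BraidWord → Equiv.Perm ℕ
  | [] => 1
  | x :: w => perm w * Equiv.swap x.1 (x.1 + 1)

/-- Position, before the letter number `k` (counted from `0`), of the strand that starts
at position `j`. -/
def pos (w : BraidWord) (k j : ℕ) : ℕ := perm (w.take k) j

/-- The components of the closure of the `n`-strand braid `w`, each given as the set of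
(the starting positions of) its strands: the cycles of the permutation of `w`. -/
def components (n : ℕ) (w : BraidWord) : Set (Set ℕ) :=
  {C | ∃ i < n, C = {j | (perm w).SameCycle i j}}

/-- The letter number `k` of `w` is a crossing between a strand of `C` and a strand of `D`. -/
def IsCrossingBetween (w : BraidWord) (C D : Set ℕ) (k : ℕ) (i : ℕ) : Prop :=
  ∃ a b : ℕ, pos w k a = i ∧ pos w k b = i + 1 ∧ (a ∈ C ∧ b ∈ D ∨ a ∈ D ∧ b ∈ C)

open Classical in
/-- The linking number of two different components of a closed braid, oriented along the
braid: half of the signed number of crossings between strands of `C` and strands of `D`. -/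
def linkingNumber (w : BraidWord) (C D : Set ℕ) : ℚ :=
  (∑ k : Fin w.length,
    if IsCrossingBetween w C D k (w.get k).1 then (((w.get k).2 : ℤ) : ℚ) else 0) / 2

/-- The sign of the letter number `k` (irrelevant past the end of the word). -/
def letterSign (w : BraidWord) (k : ℕ) : ℝ := (((w.getD k (0, 1)).2 : ℤ) : ℝ)

/-- The point at time `t` on the strand of `w` that starts at position `j`.
The letter number `k` is performed in the time interval `[k, k + 1]`; in the last interval
`[w.length, w.length + 1]` nothing happens. During a crossing the two strands exchange
their positions smoothly, and for a positive letter the strand going from `i` to `i + 1`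
passes above the other one. The closure is formed around the third coordinate axis: a
strand at position `x` has distance `1 + x` from it, and the angle is proportional to the
time. -/
def strandPoint (w : BraidWord) (j : ℕ) (t : ℝ) : E3 :=
  let k : ℕ := ⌊t⌋₊
  let a : ℝ := pos w k j
  let b : ℝ := pos w (k + 1) j
  let c : ℝ := Real.smoothTransition (t - k)
  let x : ℝ := a + (b - a) * c
  let z : ℝ := letterSign w k * (b - a) * (c * (1 - c))
  let θ : ℝ := 2 * Real.pi * t / (w.length + 1)
  !₂[(1 + x) * Real.cos θ, (1 + x) * Real.sin θ, z]

/-- The part of the closure of `w` in three-space that is formed by the strands in `C`. -/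
def closureOf (w : BraidWord) (C : Set ℕ) : Set E3 :=
  {P | ∃ j ∈ C, ∃ t ∈ Set.Icc (0 : ℝ) (w.length + 1), P = strandPoint w j t}

/-- The closure of the `n`-strand braid `w`, a link in three-space. -/
def closedBraid (n : ℕ) (w : BraidWord) : Set E3 := closureOf w (Set.Iio n)

/-! ### Twisted torus links -/

/-- The word `σ₁ σ₂ ⋯ σₙ₋₁`. -/
def sweep (n : ℕ) : BraidWord := (List.range (n - 1)).map (fun i => (i, 1))

/-- The word `σₙ₋₁⁻¹ ⋯ σ₂⁻¹ σ₁⁻¹`. -/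
def sweepInv (n : ℕ) : BraidWord := ((List.range (n - 1)).map (fun i => (i, -1))).reverse

/-- The concatenation of `k` copies of `w`. -/
def wordPow (w : BraidWord) (k : ℕ) : BraidWord := (List.replicate k w).flatten

/-- The word of `s` full twists on the first `r` strands. -/
def fullTwists (r : ℕ) (s : ℤ) : BraidWord :=
  if 0 ≤ s then wordPow (sweep r) (s.natAbs * r) else wordPow (sweepInv r) (s.natAbs * r)

/-- The `p`-strand braid of the twisted torus link `T(p, q, r, s)` (for `r ≤ p`): the braid
of the `(p, q)`-torus link followed by `s` full twists on the first `r` strands. -/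
def twistedTorusBraid (p q r : ℕ) (s : ℤ) : BraidWord :=
  wordPow (sweep p) q ++ fullTwists r s

/-- The twisted torus link `T(p, q, r, s)`, for `r ≤ p`. -/
def twistedTorusLink (p q r : ℕ) (s : ℤ) : Set E3 :=
  closedBraid p (twistedTorusBraid p q r s)

/-- The component of `T(p, q, r, s)` formed by the strands in `C` is a twisted torus knot of
type `(p', q', r', s')`. -/
def ComponentHasType (p q r : ℕ) (s : ℤ) (C : Set ℕ) (p' q' r' : ℕ) (s' : ℤ) : Prop :=
  KnotIsotopic (closureOf (twistedTorusBraid p q r s) C) (twistedTorusLink p' q' r' s')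

end TwistedTorus

end

open scoped ContDiff

noncomputable section

namespace TwistedTorus

/-! Why it is true. The sweep σ₁⋯σ_{p-1} rotates the p positions by one and full twists are pure, so
the components are the classes of strands modulo gcd(p,q), here 2. Each sweep is performed by a
single strand that crosses all the others. Delete the strands outside a class C: a sweep performed
by a strand of C becomes a sweep on the strands that remain, and any other sweep disappears. Hence q
sweeps on p strands become q/2 sweeps on p/2 strands, and s full twists on r strands become s full
twists on those a of the first r strands that lie in C. The remaining word is literally that of
T(p/2, q/2, a, s) (`del_twistedTorusBraid_of_gcd_eq_two`), where a is the rounding of r/2 up or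
down.

Linking number. Every crossing survives in exactly one component or is mixed, so the crossing signs
of the three words give pq/4 + s·a·b with a + b = r (`linkingNumber_residueClass`). Setting this to
zero gives both formulas.

Geometry. A component of a closed braid still has gaps where the other strands ran, so
`knotIsotopic_del` supplies an isotopy to the closure of the shortened word. Positions are first
interpolated linearly to ranks; when the deleted letters no longer move anything, their time is
squeezed out. Strands stay disjoint because ranks preserve the order (`interpPos_separated`). -/

/-! ### Closed curves around an axis in cylindrical coordinates -/

/-- The point with cylindrical coordinates `(1 + x, 2πT, z)`. -/
def cylPoint (x z T : ℝ) : E3 :=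
  !₂[(1 + x) * Real.cos (2 * Real.pi * T), (1 + x) * Real.sin (2 * Real.pi * T), z]

theorem cylPoint_inj {x z T x' z' T' : ℝ} (hx : 0 < 1 + x) (hx' : 0 < 1 + x')
    (h : cylPoint x z T = cylPoint x' z' T') : x = x' ∧ z = z' ∧ ∃ m : ℤ, T = T' + m := by
  have h0 := congrArg (fun v : E3 => v 0) h
  have h1 := congrArg (fun v : E3 => v 1) h
  have h2 := congrArg (fun v : E3 => v 2) h
  simp [cylPoint] at h0 h1 h2
  have hR : 1 + x = 1 + x' := by
    have e : (1 + x) ^ 2 = (1 + x') ^ 2 := by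
      have a := Real.sin_sq_add_cos_sq (2 * Real.pi * T)
      have b := Real.sin_sq_add_cos_sq (2 * Real.pi * T')
      calc (1 + x) ^ 2 = ((1 + x) * Real.cos (2 * Real.pi * T)) ^ 2
            + ((1 + x) * Real.sin (2 * Real.pi * T)) ^ 2 := by linear_combination -(1 + x) ^ 2 * a
        _ = (1 + x') ^ 2 := by rw [h0, h1]; linear_combination (1 + x') ^ 2 * b
    exact (pow_left_inj₀ hx.le hx'.le two_ne_zero).1 e
  rw [hR] at h0 h1
  have hc := mul_left_cancel₀ hx'.ne' h0
  have hs := mul_left_cancel₀ hx'.ne' h1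
  have ha : ((2 * Real.pi * T : ℝ) : Real.Angle) = ((2 * Real.pi * T' : ℝ) : Real.Angle) :=
    Real.Angle.cos_sin_inj hc hs
  obtain ⟨m, hm⟩ := Real.Angle.angle_eq_iff_two_pi_dvd_sub.1 ha
  refine ⟨by linarith, h2, m, ?_⟩
  have : (2 * Real.pi) * (T - T' - m) = 0 := by linear_combination hm
  rcases mul_eq_zero.1 this with h | h
  · exact absurd h (by positivity)
  · linarith

theorem cylPoint_add_int (x z T : ℝ) (m : ℤ) : cylPoint x z (T + m) = cylPoint x z T := by
  have e : 2 * Real.pi * (T + m) = 2 * Real.pi * T + m * (2 * Real.pi) := by ring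
  simp [cylPoint, e, Real.cos_add_int_mul_two_pi, Real.sin_add_int_mul_two_pi]

theorem cylPoint_fract (x z T : ℝ) : cylPoint x z (Int.fract T) = cylPoint x z T := by
  conv_rhs => rw [← Int.fract_add_floor T]
  rw [cylPoint_add_int]

/-- The function which on `[m, m + 1)` is the translate by `m` of the function number `m`. -/
def glue (X : ℤ → ℝ × ℝ → ℝ) (y : ℝ × ℝ) : ℝ := X ⌊y.2⌋ (y.1, Int.fract y.2)

/-- The pieces are defined for all times, and piece `m` extended to the left of `0` agrees with the
last stretch of length `δ` of piece `m - 1`. So near any point, integers included, the glued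
function is one translated smooth piece. -/
theorem contDiff_glue {X : ℤ → ℝ × ℝ → ℝ} (hX : ∀ m, ContDiff ℝ ∞ (X m)) {δ : ℝ} (hδ : 0 < δ)
    (hδ' : δ ≤ 1)
    (hglue : ∀ m t T, 1 - δ ≤ T → T ≤ 1 → X m (t, T) = X (m + 1) (t, T - 1)) :
    ContDiff ℝ ∞ (glue X) := by
  rw [contDiff_iff_contDiffAt]
  rintro ⟨t₀, T₀⟩
  have hs : ContDiff ℝ ∞ (fun y : ℝ × ℝ => X ⌊T₀⌋ (y.1, y.2 - ⌊T₀⌋)) :=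
    (hX _).comp (contDiff_fst.prodMk (contDiff_snd.sub contDiff_const))
  refine hs.contDiffAt.congr_of_eventuallyEq ?_
  have h1 : (⌊T₀⌋ : ℝ) - δ < T₀ := by linarith [Int.floor_le T₀]
  have h2 : T₀ < ⌊T₀⌋ + 1 := Int.lt_floor_add_one T₀
  have hU : IsOpen (Prod.snd ⁻¹' Set.Ioo ((⌊T₀⌋ : ℝ) - δ) (⌊T₀⌋ + 1) : Set (ℝ × ℝ)) :=
    isOpen_Ioo.preimage continuous_snd
  filter_upwards [hU.mem_nhds (show ((t₀, T₀) : ℝ × ℝ) ∈ _ from ⟨h1, h2⟩)]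
  rintro ⟨t, T⟩ ⟨ha, hb⟩
  simp only at ha hb
  rcases le_or_gt (⌊T₀⌋ : ℝ) T with h | h
  · have : ⌊T⌋ = ⌊T₀⌋ := Int.floor_eq_iff.2 ⟨h, hb⟩
    simp only [glue, this, Int.fract]
  · have : ⌊T⌋ = ⌊T₀⌋ - 1 := by
      rw [Int.floor_eq_iff]; push_cast; constructor <;> linarith
    simp only [glue, Int.fract, this]
    rw [hglue _ _ _ (by push_cast; linarith) (by push_cast; linarith)]
    push_cast
    congr 2
    · ring
    · ring

/-- The curve winds `n` times around the axis with constant angular speed at positive radius. Hence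
its velocity never vanishes, and self-intersections can only occur between points at the same angle.
-/
theorem isKnotParam_cylPoint {n : ℕ} (hn : 0 < n) {x z : ℝ → ℝ} (hx : ContDiff ℝ ∞ x)
    (hz : ContDiff ℝ ∞ z) (hxp : ∀ T, x (T + n) = x T) (hzp : ∀ T, z (T + n) = z T)
    (hpos : ∀ T, 0 < 1 + x T)
    (hinj : ∀ T T' : ℝ, T ∈ Set.Ico (0 : ℝ) n → T' ∈ Set.Ico (0 : ℝ) n →
      Int.fract T = Int.fract T' → x T = x T' → z T = z T' → T = T') :
    IsKnotParam (fun u => cylPoint (x (n * u)) (z (n * u)) (n * u)) := by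
  have hn' : (0 : ℝ) < n := by exact_mod_cast hn
  have hsm : ∀ {f : ℝ → ℝ}, ContDiff ℝ ∞ f → ContDiff ℝ ∞ (fun u : ℝ => f (n * u)) :=
    fun hf => hf.comp (contDiff_const.mul contDiff_id)
  have hφ : ContDiff ℝ ∞ (fun u : ℝ => 2 * Real.pi * (n * u)) :=
    contDiff_const.mul (contDiff_const.mul contDiff_id)
  have hsmooth : ContDiff ℝ ∞ (fun u => cylPoint (x (n * u)) (z (n * u)) (n * u)) := by
    rw [contDiff_euclidean]
    intro i
    fin_cases i
    · exact (contDiff_const.add (hsm hx)).mul (Real.contDiff_cos.comp hφ)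
    · exact (contDiff_const.add (hsm hx)).mul (Real.contDiff_sin.comp hφ)
    · exact hsm hz
  refine ⟨hsmooth, ?_, ?_, ?_⟩
  · intro u
    have e : (n : ℝ) * (u + 1) = n * u + n := by ring
    have := cylPoint_add_int (x (n * u)) (z (n * u)) (n * u) n
    simp only [e, hxp, hzp]
    exact_mod_cast this
  · intro u h0
    have hd := (hsmooth.differentiable (by simp) u).hasDerivAt
    rw [h0] at hd
    have d0 : HasDerivAt (fun u => (1 + x (n * u)) * Real.cos (2 * Real.pi * (n * u))) 0 u :=
      (EuclideanSpace.proj (𝕜 := ℝ) (0 : Fin 3)).hasFDerivAt.comp_hasDerivAt u hd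
    have d1 : HasDerivAt (fun u => (1 + x (n * u)) * Real.sin (2 * Real.pi * (n * u))) 0 u :=
      (EuclideanSpace.proj (𝕜 := ℝ) (1 : Fin 3)).hasFDerivAt.comp_hasDerivAt u hd
    have hxu := ((hsm hx).differentiable (by simp) u).hasDerivAt.const_add 1
    have hφu : HasDerivAt (fun u : ℝ => 2 * Real.pi * (n * u)) (2 * Real.pi * (n * 1)) u :=
      ((hasDerivAt_id u).const_mul (n : ℝ)).const_mul _
    have e0 := d0.unique (hxu.mul hφu.cos)
    have e1 := d1.unique (hxu.mul hφu.sin)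
    have hsc := Real.sin_sq_add_cos_sq (2 * Real.pi * (n * u))
    -- The tangential component of the velocity: radius times angular speed.
    have : (1 + x (n * u)) * (2 * Real.pi * n) = 0 := by
      linear_combination Real.sin (2 * Real.pi * (n * u)) * e0
        - Real.cos (2 * Real.pi * (n * u)) * e1 - (1 + x (n * u)) * (2 * Real.pi * n) * hsc
    have hp := hpos (n * u)
    have : 0 < (1 + x (n * u)) * (2 * Real.pi * n) := by positivity
    linarith
  · intro a ha b hb hab
    obtain ⟨h1, h2, m, hm⟩ := cylPoint_inj (hpos _) (hpos _) hab
    have hmem : ∀ c ∈ Set.Ico (0 : ℝ) 1, (n : ℝ) * c ∈ Set.Ico (0 : ℝ) n := fun c hc =>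
      ⟨mul_nonneg hn'.le hc.1, by nlinarith [hc.2]⟩
    have := hinj _ _ (hmem a ha) (hmem b hb) (by rw [hm, Int.fract_add_intCast]) h1 h2
    exact mul_left_cancel₀ hn'.ne' this

theorem glue_add {X : ℤ → ℝ × ℝ → ℝ} {n : ℕ} (hX : ∀ m, X (m + n) = X m) (t T : ℝ) :
    glue X (t, T + n) = glue X (t, T) := by
  simp [glue, hX]

/-- The union of the arcs of a closed curve given strand by strand in cylindrical coordinates. -/
def arcsUnion (X Z : ℤ → ℝ × ℝ → ℝ) (t : ℝ) : Set E3 :=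
  {P | ∃ m : ℤ, ∃ T ∈ Set.Ico (0 : ℝ) 1, P = cylPoint (X m (t, T)) (Z m (t, T)) T}

/-- Arc `m` ends where arc `m + 1` begins, and the `n` arcs close up to one curve of `n` turns.
Since distinct arcs never meet at a common angle, this curve is embedded at every time `t`. -/
theorem knotIsotopic_arcsUnion {n : ℕ} (hn : 0 < n) {X Z : ℤ → ℝ × ℝ → ℝ}
    (hX : ∀ m, ContDiff ℝ ∞ (X m)) (hZ : ∀ m, ContDiff ℝ ∞ (Z m)) {δ : ℝ} (hδ : 0 < δ)
    (hδ' : δ ≤ 1)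
    (hXg : ∀ m t T, 1 - δ ≤ T → T ≤ 1 → X m (t, T) = X (m + 1) (t, T - 1))
    (hZg : ∀ m t T, 1 - δ ≤ T → T ≤ 1 → Z m (t, T) = Z (m + 1) (t, T - 1))
    (hXp : ∀ m, X (m + n) = X m) (hZp : ∀ m, Z (m + n) = Z m)
    (hpos : ∀ m y, 0 < 1 + X m y)
    (hinj : ∀ y m m', X m y = X m' y → Z m y = Z m' y → (n : ℤ) ∣ m - m') :
    KnotIsotopic (arcsUnion X Z 0) (arcsUnion X Z 1) := by
  have hn' : (0 : ℝ) < n := by exact_mod_cast hn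
  have hgX := contDiff_glue hX hδ hδ' hXg
  have hgZ := contDiff_glue hZ hδ hδ' hZg
  have harg : ContDiff ℝ ∞ (fun y : ℝ × ℝ => (y.1, (n : ℝ) * y.2)) :=
    contDiff_fst.prodMk (contDiff_const.mul contDiff_snd)
  have hφ : ContDiff ℝ ∞ (fun y : ℝ × ℝ => 2 * Real.pi * (n * y.2)) :=
    contDiff_const.mul (contDiff_const.mul contDiff_snd)
  have hrange : ∀ t, Set.range (fun u : ℝ =>
      cylPoint (glue X (t, n * u)) (glue Z (t, n * u)) (n * u)) = arcsUnion X Z t := by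
    intro t
    ext P
    constructor
    · rintro ⟨u, rfl⟩
      exact ⟨⌊(n : ℝ) * u⌋, Int.fract ((n : ℝ) * u), ⟨Int.fract_nonneg _, Int.fract_lt_one _⟩,
        (cylPoint_fract _ _ _).symm⟩
    · rintro ⟨m, T, hT, rfl⟩
      refine ⟨(T + m) / n, ?_⟩
      have e : (n : ℝ) * ((T + m) / n) = T + m := by field_simp
      have e1 : ⌊T⌋ = 0 := Int.floor_eq_zero_iff.2 hT
      have e2 : Int.fract T = T := Int.fract_eq_self.2 hT
      simp only [e, glue, cylPoint_add_int, Int.floor_add_intCast, Int.fract_add_intCast, e1, e2,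
        zero_add]
  refine ⟨fun y => cylPoint (glue X (y.1, n * y.2)) (glue Z (y.1, n * y.2)) (n * y.2),
    ?_, ?_, hrange 0, hrange 1⟩
  · rw [contDiff_euclidean]
    intro i
    fin_cases i
    · exact (contDiff_const.add (hgX.comp harg)).mul (Real.contDiff_cos.comp hφ)
    · exact (contDiff_const.add (hgX.comp harg)).mul (Real.contDiff_sin.comp hφ)
    · exact hgZ.comp harg
  · intro t _
    refine isKnotParam_cylPoint (x := fun T => glue X (t, T)) (z := fun T => glue Z (t, T)) hn
      (hgX.comp (contDiff_const.prodMk contDiff_id)) (hgZ.comp (contDiff_const.prodMk contDiff_id))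
      (fun T => glue_add hXp t T) (fun T => glue_add hZp t T) (fun T => hpos _ _) ?_
    intro T T' hT hT' hf h1 h2
    simp only [glue, hf] at h1 h2
    have hd := hinj _ _ _ h1 h2
    have b : ∀ T ∈ Set.Ico (0 : ℝ) n, 0 ≤ ⌊T⌋ ∧ ⌊T⌋ < n := fun T hT =>
      ⟨Int.floor_nonneg.2 hT.1, Int.floor_lt.2 (by exact_mod_cast hT.2)⟩
    have b1 := b T hT
    have b2 := b T' hT'
    have : ⌊T⌋ - ⌊T'⌋ = 0 := Int.eq_zero_of_abs_lt_dvd hd (by rw [abs_lt]; omega)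
    rw [← Int.fract_add_floor T, ← Int.fract_add_floor T', hf, sub_eq_zero.1 this]

/-! ### Deleting strands from a braid word -/

/-- The positions at the end of `w` of the strands that start in `C`. -/
def push (w : BraidWord) (C : Set ℕ) : Set ℕ := {j | (perm w)⁻¹ j ∈ C}

open Classical in
/-- The number of elements of `C` below `i`. -/
def rank (C : Set ℕ) (i : ℕ) : ℕ := Nat.count (· ∈ C) i

open Classical in
/-- The word obtained from `w` by deleting all strands that do not start in `C`. -/
def del : BraidWord → Set ℕ → BraidWord
  | [], _ => []
  | x :: w, C =>
    if x.1 ∈ C ∧ x.1 + 1 ∈ C then (rank C x.1, x.2) :: del w (push [x] C)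
    else del w (push [x] C)

theorem perm_append (u v : BraidWord) : perm (u ++ v) = perm v * perm u := by
  induction u with
  | nil => simp [perm]
  | cons x u ih => simp [perm, ih, mul_assoc]

theorem push_nil (C : Set ℕ) : push [] C = C := by simp [push, perm]

theorem push_append (u v : BraidWord) (C : Set ℕ) : push (u ++ v) C = push v (push u C) := by
  ext j; simp [push, perm_append]

theorem mem_push_singleton (x : ℕ × ℤˣ) (C : Set ℕ) (j : ℕ) :
    j ∈ push [x] C ↔ Equiv.swap x.1 (x.1 + 1) j ∈ C := by
  simp [push, perm]

theorem perm_mem_push {w : BraidWord} {C : Set ℕ} {j : ℕ} : perm w j ∈ push w C ↔ j ∈ C := by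
  simp [push]

theorem del_append (u v : BraidWord) (C : Set ℕ) :
    del (u ++ v) C = del u C ++ del v (push u C) := by
  induction u generalizing C with
  | nil => simp [del, push_nil]
  | cons x u ih =>
    have : push (x :: u) C = push u (push [x] C) := push_append [x] u C
    simp only [List.cons_append, del, ih, this]
    split_ifs <;> simp

theorem rank_zero (C : Set ℕ) : rank C 0 = 0 := by simp [rank]

open Classical in
theorem rank_succ (C : Set ℕ) (i : ℕ) : rank C (i + 1) = rank C i + if i ∈ C then 1 else 0 := by
  simp [rank, Nat.count_succ]

theorem rank_succ_of_mem {C : Set ℕ} {i : ℕ} (h : i ∈ C) : rank C (i + 1) = rank C i + 1 := by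
  simp [rank_succ, h]

theorem rank_succ_of_notMem {C : Set ℕ} {i : ℕ} (h : i ∉ C) : rank C (i + 1) = rank C i := by
  simp [rank_succ, h]

theorem rank_congr {C D : Set ℕ} {i : ℕ} (h : ∀ j < i, j ∈ C ↔ j ∈ D) : rank C i = rank D i := by
  induction i with
  | zero => simp [rank_zero]
  | succ i ih =>
    have ih' := ih fun j hj => h j (by omega)
    have hi := h i (by omega)
    by_cases hC : i ∈ C
    · rw [rank_succ_of_mem hC, rank_succ_of_mem (hi.1 hC), ih']
    · rw [rank_succ_of_notMem hC, rank_succ_of_notMem (mt hi.2 hC), ih']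

open Classical in
theorem rank_mono (C : Set ℕ) {i j : ℕ} (h : i ≤ j) : rank C i ≤ rank C j :=
  Nat.count_monotone _ h

theorem rank_lt_rank {C : Set ℕ} {i j : ℕ} (hi : i ∈ C) (h : i < j) : rank C i < rank C j := by
  have := rank_succ_of_mem hi
  have := rank_mono C (show i + 1 ≤ j from h)
  omega

theorem rank_push_of_le {x : ℕ × ℤˣ} {C : Set ℕ} {i : ℕ} (h : i ≤ x.1) :
    rank (push [x] C) i = rank C i := by
  refine rank_congr fun j hj => ?_
  rw [mem_push_singleton, Equiv.swap_apply_of_ne_of_ne (by omega) (by omega)]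

/-- Both exchanged positions lie below `i`, so the count below `i` is unaffected. -/
theorem rank_push_of_ge {x : ℕ × ℤˣ} {C : Set ℕ} {i : ℕ} (h : x.1 + 2 ≤ i) :
    rank (push [x] C) i = rank C i := by
  induction i, h using Nat.le_induction with
  | base =>
    have h0 : x.1 ∈ push [x] C ↔ x.1 + 1 ∈ C := by simp [mem_push_singleton]
    have h1 : x.1 + 1 ∈ push [x] C ↔ x.1 ∈ C := by simp [mem_push_singleton]
    rw [rank_succ, rank_succ, rank_succ C, rank_succ C, rank_push_of_le le_rfl]
    by_cases ha : x.1 ∈ C <;> by_cases hb : x.1 + 1 ∈ C <;> simp [h0, h1, ha, hb]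
  | succ i hi ih =>
    have : i ∈ push [x] C ↔ i ∈ C := by
      rw [mem_push_singleton, Equiv.swap_apply_of_ne_of_ne (by omega) (by omega)]
    by_cases hC : i ∈ C
    · rw [rank_succ_of_mem hC, rank_succ_of_mem (this.2 hC), ih]
    · rw [rank_succ_of_notMem hC, rank_succ_of_notMem (mt this.1 hC), ih]

/-- Deletion of strands is compatible with the permutations. -/
theorem perm_del_rank (w : BraidWord) (C : Set ℕ) {j : ℕ} (hj : j ∈ C) :
    perm (del w C) (rank C j) = rank (push w C) (perm w j) := by
  induction w generalizing C j with
  | nil => simp [del, perm, push_nil]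
  | cons x w ih =>
    have hp : push (x :: w) C = push w (push [x] C) := push_append [x] w C
    have hmem : Equiv.swap x.1 (x.1 + 1) j ∈ push [x] C := by
      rw [mem_push_singleton]; simpa using hj
    have ih' := ih (push [x] C) hmem
    rw [hp]
    simp only [perm, Equiv.Perm.mul_apply]
    rw [← ih']
    -- If both strands are kept, their ranks are consecutive and the surviving letter exchanges
    -- them. Otherwise a kept strand at most passes a deleted one, which does not change its rank.
    by_cases hx : x.1 ∈ C ∧ x.1 + 1 ∈ C
    · rw [del, if_pos hx]
      simp only [perm, Equiv.Perm.mul_apply]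
      congr 1
      have h1 := rank_succ_of_mem hx.1
      have h2 : rank (push [x] C) x.1 = rank C x.1 := rank_push_of_le le_rfl
      have h3 : rank (push [x] C) (x.1 + 1) = rank C x.1 + 1 := by
        rw [rank_succ_of_mem, h2]
        rw [mem_push_singleton]; simpa using hx.2
      rcases eq_or_ne j x.1 with rfl | h
      · simp [h3]
      rcases eq_or_ne j (x.1 + 1) with rfl | h'
      · simp [h2, h1]
      rw [Equiv.swap_apply_of_ne_of_ne h h']
      rcases lt_or_gt_of_ne h with h | h
      · rw [rank_push_of_le h.le]
        have := rank_lt_rank hj h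
        rw [Equiv.swap_apply_of_ne_of_ne (by omega) (by omega)]
      · rw [rank_push_of_ge (by omega)]
        have := rank_lt_rank hx.2 (show x.1 + 1 < j by omega)
        rw [Equiv.swap_apply_of_ne_of_ne (by omega) (by omega)]
    · rw [del, if_neg hx]
      congr 1
      rcases eq_or_ne j x.1 with rfl | h
      · rw [Equiv.swap_apply_left, rank_succ_of_notMem, rank_push_of_le le_rfl]
        rw [mem_push_singleton]; simp; tauto
      rcases eq_or_ne j (x.1 + 1) with rfl | h'
      · rw [Equiv.swap_apply_right, rank_push_of_le le_rfl, rank_succ_of_notMem]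
        tauto
      rw [Equiv.swap_apply_of_ne_of_ne h h']
      rcases lt_or_gt_of_ne h with h | h
      · rw [rank_push_of_le h.le]
      · rw [rank_push_of_ge (by omega)]

/-! ### Matching the letters of a word with the surviving letters -/

theorem del_take_prefix (w : BraidWord) (C : Set ℕ) (k : ℕ) :
    del (w.take k) C <+: del w C := by
  conv_rhs => rw [← List.take_append_drop k w, del_append]
  exact List.prefix_append _ _

/-- The number of letters among the first `k` letters of `w` that survive the deletion. -/
def kept (w : BraidWord) (C : Set ℕ) (k : ℕ) : ℕ := (del (w.take k) C).length

theorem take_kept (w : BraidWord) (C : Set ℕ) (k : ℕ) :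
    (del w C).take (kept w C k) = del (w.take k) C :=
  (List.prefix_iff_eq_take.1 (del_take_prefix w C k)).symm

theorem pos_zero (w : BraidWord) (j : ℕ) : pos w 0 j = j := by simp [pos, perm]

theorem pos_length (w : BraidWord) (j : ℕ) : pos w w.length j = perm w j := by simp [pos]

theorem take_succ_eq (w : BraidWord) {k : ℕ} (hk : k < w.length) :
    w.take (k + 1) = w.take k ++ [w[k]] := by simp

theorem pos_succ (w : BraidWord) {k : ℕ} (hk : k < w.length) (j : ℕ) :
    pos w (k + 1) j = Equiv.swap w[k].1 (w[k].1 + 1) (pos w k j) := by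
  rw [pos, take_succ_eq w hk, perm_append]; simp [perm, pos]

theorem pos_of_length_le (w : BraidWord) {k : ℕ} (hk : w.length ≤ k) (j : ℕ) :
    pos w k j = perm w j := by
  rw [pos, List.take_of_length_le hk]

theorem pos_injective (w : BraidWord) (k : ℕ) : Function.Injective (pos w k) :=
  (perm (w.take k)).injective

/-- Position in the word with deleted strands. -/
theorem pos_del (w : BraidWord) (C : Set ℕ) (k : ℕ) {j : ℕ} (hj : j ∈ C) :
    pos (del w C) (kept w C k) (rank C j) = rank (push (w.take k) C) (pos w k j) := by
  rw [pos, take_kept, perm_del_rank _ _ hj, pos]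

theorem kept_zero (w : BraidWord) (C : Set ℕ) : kept w C 0 = 0 := by simp [kept, del]

theorem kept_length (w : BraidWord) (C : Set ℕ) : kept w C w.length = (del w C).length := by
  simp [kept]

theorem del_take_succ_of_mem (w : BraidWord) (C : Set ℕ) {k : ℕ} (hk : k < w.length)
    (h : w[k].1 ∈ push (w.take k) C ∧ w[k].1 + 1 ∈ push (w.take k) C) :
    del (w.take (k + 1)) C = del (w.take k) C ++ [(rank (push (w.take k) C) w[k].1, w[k].2)] := by
  rw [take_succ_eq w hk, del_append, del, if_pos h, del]

theorem del_take_succ_of_notMem (w : BraidWord) (C : Set ℕ) {k : ℕ} (hk : k < w.length)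
    (h : ¬ (w[k].1 ∈ push (w.take k) C ∧ w[k].1 + 1 ∈ push (w.take k) C)) :
    del (w.take (k + 1)) C = del (w.take k) C := by
  rw [take_succ_eq w hk, del_append, del, if_neg h, del, List.append_nil]

theorem kept_succ_of_mem (w : BraidWord) (C : Set ℕ) {k : ℕ} (hk : k < w.length)
    (h : w[k].1 ∈ push (w.take k) C ∧ w[k].1 + 1 ∈ push (w.take k) C) :
    kept w C (k + 1) = kept w C k + 1 := by
  simp [kept, del_take_succ_of_mem w C hk h, -List.take_append_getElem]

theorem kept_succ_of_notMem (w : BraidWord) (C : Set ℕ) {k : ℕ} (hk : k < w.length)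
    (h : ¬ (w[k].1 ∈ push (w.take k) C ∧ w[k].1 + 1 ∈ push (w.take k) C)) :
    kept w C (k + 1) = kept w C k := by
  rw [kept, del_take_succ_of_notMem w C hk h, kept]

theorem kept_mono (w : BraidWord) (C : Set ℕ) : Monotone (kept w C) := by
  intro a b hab
  have : w.take a = (w.take b).take a := by rw [List.take_take, min_eq_left hab]
  rw [kept, this]
  exact (del_take_prefix (w.take b) C a).length_le

theorem letterSign_eq (w : BraidWord) {k : ℕ} (hk : k < w.length) :
    letterSign w k = (((w[k]).2 : ℤ) : ℝ) := by
  simp [letterSign, hk]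

theorem letterSign_del (w : BraidWord) (C : Set ℕ) {k : ℕ} (hk : k < w.length)
    (h : kept w C (k + 1) ≠ kept w C k) :
    letterSign (del w C) (kept w C k) = letterSign w k := by
  have hm : w[k].1 ∈ push (w.take k) C ∧ w[k].1 + 1 ∈ push (w.take k) C := by
    by_contra hm
    exact h (kept_succ_of_notMem w C hk hm)
  have hp := del_take_prefix w C (k + 1)
  rw [del_take_succ_of_mem w C hk hm] at hp
  obtain ⟨v, hv⟩ := hp
  rw [letterSign_eq w hk, letterSign, ← hv]
  simp [kept, List.getD]

/-! ### Paths made of consecutive steps -/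

/-- A path that moves from `f k` to `f (k + 1)` in the time interval `[β k, β k + 1]`,
for `k < L`. -/
def stepSum (L : ℕ) (f β : ℕ → ℝ) (τ : ℝ) : ℝ :=
  f 0 + ∑ k ∈ Finset.range L, (f (k + 1) - f k) * Real.smoothTransition (τ - β k)

/-- The height belonging to `stepSum`, where the step number `k` has sign `e k`. -/
def bumpSum (L : ℕ) (f e β : ℕ → ℝ) (τ : ℝ) : ℝ :=
  ∑ k ∈ Finset.range L, e k * (f (k + 1) - f k) *
    (Real.smoothTransition (τ - β k) * (1 - Real.smoothTransition (τ - β k)))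

/-- Finished or trivial steps telescope, and each bump `c * (1 - c)` is back to zero at `c = 1`. -/
theorem stepSum_eq_end {L : ℕ} {f β : ℕ → ℝ} {τ : ℝ}
    (h : ∀ k < L, f (k + 1) = f k ∨ β k + 1 ≤ τ) (e : ℕ → ℝ) :
    stepSum L f β τ = f L ∧ bumpSum L f e β τ = 0 := by
  constructor
  · have : ∑ k ∈ Finset.range L, (f (k + 1) - f k) * Real.smoothTransition (τ - β k) =
        ∑ k ∈ Finset.range L, (f (k + 1) - f k) := by
      refine Finset.sum_congr rfl fun k hk => ?_
      rcases h k (Finset.mem_range.1 hk) with h | h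
      · simp [h]
      · rw [Real.smoothTransition.one_of_one_le (by linarith), mul_one]
    rw [stepSum, this, Finset.sum_range_sub]; ring
  · refine Finset.sum_eq_zero fun k hk => ?_
    rcases h k (Finset.mem_range.1 hk) with h | h
    · simp [h]
    · simp [Real.smoothTransition.one_of_one_le (show 1 ≤ τ - β k by linarith)]

theorem stepSum_succ (L : ℕ) (f β : ℕ → ℝ) (τ : ℝ) :
    stepSum (L + 1) f β τ =
      stepSum L f β τ + (f (L + 1) - f L) * Real.smoothTransition (τ - β L) := by
  rw [stepSum, stepSum, Finset.sum_range_succ, add_assoc]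

theorem bumpSum_succ (L : ℕ) (f e β : ℕ → ℝ) (τ : ℝ) :
    bumpSum (L + 1) f e β τ = bumpSum L f e β τ + e L * (f (L + 1) - f L) *
      (Real.smoothTransition (τ - β L) * (1 - Real.smoothTransition (τ - β L))) := by
  rw [bumpSum, bumpSum, Finset.sum_range_succ]

theorem stepSum_eq_of_le {K L : ℕ} {f β : ℕ → ℝ} {τ : ℝ} (hKL : K ≤ L)
    (h : ∀ k, K ≤ k → k < L → f (k + 1) = f k ∨ τ ≤ β k) (e : ℕ → ℝ) :
    stepSum L f β τ = stepSum K f β τ ∧ bumpSum L f e β τ = bumpSum K f e β τ := by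
  induction L, hKL using Nat.le_induction with
  | base => simp
  | succ L hL ih =>
    obtain ⟨h1, h2⟩ := ih fun k hk hk' => h k hk (by omega)
    rw [stepSum_succ, bumpSum_succ, h1, h2]
    rcases h L hL (by omega) with h | h
    · simp [h]
    · simp [Real.smoothTransition.zero_of_nonpos (show τ - β L ≤ 0 by linarith)]

theorem stepSum_eq_start {L : ℕ} {f β : ℕ → ℝ} {τ : ℝ} (h : ∀ k < L, τ ≤ β k) (e : ℕ → ℝ) :
    stepSum L f β τ = f 0 ∧ bumpSum L f e β τ = 0 := by
  simpa [stepSum, bumpSum] using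
    stepSum_eq_of_le (K := 0) (f := f) (Nat.zero_le L) (fun k _ hk => Or.inr (h k hk)) e

/-- If the active steps do not overlap, then at each time at most one step is performed. -/
theorem exists_current_step (L : ℕ) (A : ℕ → Prop) (e β : ℕ → ℝ)
    (hA : ∀ k k', k < k' → k' < L → A k → A k' → β k + 1 ≤ β k') (τ : ℝ) :
    ∃ (K : ℕ) (c : ℝ), 0 ≤ c ∧ c ≤ 1 ∧ (K < L ∨ c = 0) ∧
      ∀ f : ℕ → ℝ, (∀ k < L, ¬ A k → f (k + 1) = f k) →
        stepSum L f β τ = f K + (f (K + 1) - f K) * c ∧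
        bumpSum L f e β τ = e K * (f (K + 1) - f K) * (c * (1 - c)) := by
  -- `K` and `c` are chosen before `f`, so all strands share the same stage of the same step and can
  -- be compared.
  induction L with
  | zero => exact ⟨0, 0, le_rfl, zero_le_one, Or.inr rfl, fun f _ => by simp [stepSum, bumpSum]⟩
  | succ L ih =>
    by_cases h : A L ∧ β L ≤ τ
    · refine ⟨L, Real.smoothTransition (τ - β L), Real.smoothTransition.nonneg _,
        Real.smoothTransition.le_one _, Or.inl (Nat.lt_succ_self L), fun f hf => ?_⟩
      have := stepSum_eq_end (L := L) (f := f) (β := β) (τ := τ) (fun k hk => by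
        by_cases hk' : A k
        · exact Or.inr (by linarith [hA k L hk (by omega) hk' h.1])
        · exact Or.inl (hf k (by omega) hk')) e
      rw [stepSum_succ, bumpSum_succ, this.1, this.2, zero_add]
      exact ⟨rfl, rfl⟩
    · obtain ⟨K, c, h0, h1, hK, H⟩ := ih fun k k' hk hk' => hA k k' hk (by omega)
      refine ⟨K, c, h0, h1, hK.imp_left (by omega), fun f hf => ?_⟩
      have := stepSum_eq_of_le (f := f) (β := β) (τ := τ) (Nat.le_succ L) (fun k hk hk' => by
        obtain rfl : k = L := by omega
        by_cases hk : A k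
        · exact Or.inr (le_of_not_ge fun h' => h ⟨hk, h'⟩)
        · exact Or.inl (hf k hk' hk)) e
      rw [this.1, this.2]
      exact H f fun k hk => hf k (by omega)

/-- At time `τ` the letters before `⌊τ⌋₊` are completed and the later ones have not begun. So the
piecewise formula is a single sum of smooth steps, valid across the integer times. -/
theorem strandPoint_eq (w : BraidWord) (j : ℕ) {T : ℝ} (hT : 0 ≤ T) :
    strandPoint w j ((w.length + 1) * T) =
      cylPoint (stepSum w.length (fun k => pos w k j) (fun k => k) ((w.length + 1) * T))
        (bumpSum w.length (fun k => pos w k j) (letterSign w) (fun k => k)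
          ((w.length + 1) * T)) T := by
  have hL : (0 : ℝ) < w.length + 1 := by positivity
  have hang : 2 * Real.pi * ((w.length + 1) * T) / (w.length + 1) = 2 * Real.pi * T := by
    field_simp
  simp only [strandPoint, hang]
  set τ := ((w.length : ℝ) + 1) * T with hτ
  have hτ0 : 0 ≤ τ := by positivity
  have hfl := Nat.floor_le hτ0
  have hlt := Nat.lt_floor_add_one τ
  set K := ⌊τ⌋₊
  rcases lt_or_ge K w.length with hK | hK
  · have h1 := stepSum_eq_of_le (f := fun k => (pos w k j : ℝ)) (β := fun k => (k : ℝ)) (τ := τ)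
      (K := K + 1) (L := w.length) hK (fun k hk _ => by
        right
        have : ((K + 1 : ℕ) : ℝ) ≤ k := by exact_mod_cast hk
        push_cast at this; linarith) (letterSign w)
    have h2 := stepSum_eq_end (f := fun k => (pos w k j : ℝ)) (β := fun k => (k : ℝ)) (τ := τ)
      (L := K) (fun k hk => by
        right
        have : ((k + 1 : ℕ) : ℝ) ≤ K := by exact_mod_cast hk
        push_cast at this; linarith) (letterSign w)
    rw [h1.1, h1.2, stepSum_succ, bumpSum_succ, h2.1, h2.2, zero_add]
    rfl
  · have h2 := stepSum_eq_end (f := fun k => (pos w k j : ℝ)) (β := fun k => (k : ℝ)) (τ := τ)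
      (L := w.length) (fun k hk => by
        right
        have : ((k + 1 : ℕ) : ℝ) ≤ K := by exact_mod_cast (by omega)
        push_cast at this; linarith) (letterSign w)
    rw [h2.1, h2.2, pos_of_length_le w hK, pos_of_length_le w (by omega : w.length ≤ K + 1),
      pos_length]
    simp [cylPoint]

/-- The end point of strand `j` is the starting point of strand `perm w j`, so a half-open turn of
each strand suffices. -/
theorem closureOf_eq (w : BraidWord) (C : Set ℕ) (hC : ∀ j ∈ C, perm w j ∈ C) :
    closureOf w C = {P | ∃ j ∈ C, ∃ T ∈ Set.Ico (0 : ℝ) 1, P =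
      cylPoint (stepSum w.length (fun k => pos w k j) (fun k => k) ((w.length + 1) * T))
        (bumpSum w.length (fun k => pos w k j) (letterSign w) (fun k => k)
          ((w.length + 1) * T)) T} := by
  have hL : (0 : ℝ) < w.length + 1 := by positivity
  ext P
  constructor
  · rintro ⟨j, hj, t, ht, rfl⟩
    have e : t = (w.length + 1) * (t / (w.length + 1)) := by field_simp
    have ht0 : 0 ≤ t / (w.length + 1) := div_nonneg ht.1 hL.le
    rcases ht.2.lt_or_eq with h | h
    · exact ⟨j, hj, t / (w.length + 1), ⟨ht0, (div_lt_one hL).2 h⟩,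
        by rw [← strandPoint_eq w j ht0, ← e]⟩
    · refine ⟨perm w j, hC j hj, 0, by simp, ?_⟩
      rw [e, strandPoint_eq w j ht0, ← e, h, div_self hL.ne']
      have h1 := stepSum_eq_end (f := fun k => (pos w k j : ℝ)) (β := fun k => (k : ℝ))
        (τ := w.length + 1) (L := w.length) (fun k hk => by
          right
          have : (k : ℝ) ≤ w.length := by exact_mod_cast hk.le
          linarith) (letterSign w)
      have h2 := stepSum_eq_start (f := fun k => (pos w k (perm w j) : ℝ))
        (β := fun k => (k : ℝ)) (τ := (w.length + 1) * 0) (L := w.length)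
        (fun k hk => by simp) (letterSign w)
      rw [h1.1, h1.2, h2.1, h2.2, pos_length, pos_zero]
      simpa using cylPoint_add_int (perm w j) 0 0 1
  · rintro ⟨j, hj, T, hT, rfl⟩
    refine ⟨j, hj, (w.length + 1) * T, ⟨by have := hT.1; positivity, ?_⟩,
      (strandPoint_eq w j hT.1).symm⟩
    nlinarith [hT.2]

/-! ### The isotopy that removes the gaps of deleted strands -/

/-- The interpolation between the position of a strand in `w` and its position in the word
from which the strands outside `C` are deleted. -/
def interpPos (w : BraidWord) (C : Set ℕ) (u : ℝ) (j k : ℕ) : ℝ :=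
  (1 - u) * pos w k j + u * rank (push (w.take k) C) (pos w k j)

/-- The interpolation between the time of a letter in `w` and its time in the word from which
the strands outside `C` are deleted. -/
def interpTime (w : BraidWord) (C : Set ℕ) (v : ℝ) (k : ℕ) : ℝ :=
  (1 - v) * k + v * kept w C k

/-- The duration of one revolution when the times of the letters are given by `interpTime`. -/
def interpPeriod (w : BraidWord) (C : Set ℕ) (v : ℝ) : ℝ :=
  (1 - v) * (w.length + 1) + v * ((del w C).length + 1)

theorem pos_mem_push {w : BraidWord} {C : Set ℕ} {k j : ℕ} :
    pos w k j ∈ push (w.take k) C ↔ j ∈ C := perm_mem_push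

/-- Position and rank both jump by at least one from a kept strand to a later one, hence so does
every convex combination. -/
theorem interpPos_add_one_le {w : BraidWord} {C : Set ℕ} {u : ℝ} (h0 : 0 ≤ u) (h1 : u ≤ 1)
    {j l k : ℕ} (hj : j ∈ C) (h : pos w k j < pos w k l) :
    interpPos w C u j k + 1 ≤ interpPos w C u l k := by
  have hr := rank_lt_rank (pos_mem_push.2 hj) h
  have a : (pos w k j : ℝ) + 1 ≤ pos w k l := by exact_mod_cast h
  have b : (rank (push (w.take k) C) (pos w k j) : ℝ) + 1 ≤
      rank (push (w.take k) C) (pos w k l) := by exact_mod_cast hr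
  have := mul_le_mul_of_nonneg_left a (sub_nonneg.2 h1)
  have := mul_le_mul_of_nonneg_left b h0
  unfold interpPos
  linarith

theorem interpPos_nonneg {w : BraidWord} {C : Set ℕ} {u : ℝ} (h0 : 0 ≤ u) (h1 : u ≤ 1)
    (j k : ℕ) : 0 ≤ interpPos w C u j k := by
  have := sub_nonneg.2 h1
  unfold interpPos
  positivity

theorem push_take_succ (w : BraidWord) (C : Set ℕ) {k : ℕ} (hk : k < w.length) :
    push (w.take (k + 1)) C = push [w[k]] (push (w.take k) C) := by
  rw [take_succ_eq w hk, push_append]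

theorem interpPos_crossing {w : BraidWord} {C : Set ℕ} (u : ℝ) {j l k : ℕ} (hk : k < w.length)
    (hj : j ∈ C) (hl : l ∈ C) (hpj : pos w k j = w[k].1) (hpl : pos w k l = w[k].1 + 1) :
    interpPos w C u l k = interpPos w C u j k + 1 ∧
    interpPos w C u j (k + 1) = interpPos w C u l k ∧
    interpPos w C u l (k + 1) = interpPos w C u j k := by
  have hj' := (pos_mem_push (w := w) (k := k)).2 hj
  have hl' := (pos_mem_push (w := w) (k := k)).2 hl
  rw [hpj] at hj'
  rw [hpl] at hl'
  have r1 := rank_succ_of_mem hj'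
  have r2 : rank (push [w[k]] (push (w.take k) C)) w[k].1 = rank (push (w.take k) C) w[k].1 :=
    rank_push_of_le le_rfl
  have r3 : rank (push [w[k]] (push (w.take k) C)) (w[k].1 + 1) =
      rank (push (w.take k) C) w[k].1 + 1 := by
    rw [rank_succ_of_mem, r2]
    rw [mem_push_singleton]; simpa using hl'
  simp only [interpPos, pos_succ w hk, hpj, hpl, push_take_succ w C hk, Equiv.swap_apply_left,
    Equiv.swap_apply_right, r1, r2, r3]
  push_cast
  refine ⟨by ring, trivial, trivial⟩

/-- Embeddedness of the isotopy. Strands that do not cross each other at letter `k` keep their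
order, with gap at least one before and after, hence throughout. Strands that cross have equal
radius only at `c = 1 / 2`, where their heights are opposite and nonzero. -/
theorem interpPos_separated {w : BraidWord} {C : Set ℕ} {u : ℝ} (h0 : 0 ≤ u) (h1 : u ≤ 1)
    {k : ℕ} {c : ℝ} (hc0 : 0 ≤ c) (hc1 : c ≤ 1) (hk : k < w.length ∨ c = 0) {j l : ℕ}
    (hj : j ∈ C) (hl : l ∈ C)
    (hx : interpPos w C u j k + (interpPos w C u j (k + 1) - interpPos w C u j k) * c =
      interpPos w C u l k + (interpPos w C u l (k + 1) - interpPos w C u l k) * c)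
    (hz : letterSign w k * (interpPos w C u j (k + 1) - interpPos w C u j k) * (c * (1 - c)) =
      letterSign w k * (interpPos w C u l (k + 1) - interpPos w C u l k) * (c * (1 - c))) :
    j = l := by
  by_contra hne
  wlog hlt : pos w k j < pos w k l generalizing j l
  · have hp : pos w k j ≠ pos w k l := fun h => hne (pos_injective w k h)
    exact hp.lt_or_gt.elim hlt (this hl hj hx.symm hz.symm (Ne.symm hne))
  have hf := interpPos_add_one_le h0 h1 hj hlt
  rcases hk with hk | rfl
  swap
  · linarith
  by_cases hcr : pos w k j = w[k].1 ∧ pos w k l = w[k].1 + 1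
  · obtain ⟨e1, e2, e3⟩ := interpPos_crossing u hk hj hl hcr.1 hcr.2
    rw [e2, e3, e1] at hx hz
    have hc : c = 1 / 2 := by linarith
    have hs : letterSign w k = 0 := by rw [hc] at hz; linarith
    rw [letterSign_eq w hk] at hs
    exact (w[k].2).ne_zero (by exact_mod_cast hs)
  · have hlt' : pos w (k + 1) j < pos w (k + 1) l := by
      rw [pos_succ w hk, pos_succ w hk, Equiv.swap_apply_def, Equiv.swap_apply_def]
      split_ifs <;> omega
    have hf' := interpPos_add_one_le h0 h1 hj hlt'
    have := mul_le_mul_of_nonneg_left hf (sub_nonneg.2 hc1)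
    have := mul_le_mul_of_nonneg_left hf' hc0
    linarith

theorem interpPos_one {w : BraidWord} {C : Set ℕ} {j : ℕ} (hj : j ∈ C) (k : ℕ) :
    interpPos w C 1 j k = pos (del w C) (kept w C k) (rank C j) := by
  rw [pos_del w C k hj, interpPos]; ring

theorem interpPos_zero (w : BraidWord) (C : Set ℕ) (j k : ℕ) :
    interpPos w C 0 j k = pos w k j := by
  rw [interpPos]; ring

theorem kept_succ_eq_or (w : BraidWord) (C : Set ℕ) {k : ℕ} (hk : k < w.length) :
    kept w C (k + 1) = kept w C k + 1 ∨ kept w C (k + 1) = kept w C k := by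
  by_cases h : w[k].1 ∈ push (w.take k) C ∧ w[k].1 + 1 ∈ push (w.take k) C
  · exact Or.inl (kept_succ_of_mem w C hk h)
  · exact Or.inr (kept_succ_of_notMem w C hk h)

/-- `kept w C` maps the surviving letters bijectively, in order, onto the letters of `del w C`. -/
theorem sum_kept (w : BraidWord) (C : Set ℕ) (G : ℕ → ℝ) :
    ∑ k ∈ Finset.range w.length, (if kept w C (k + 1) = kept w C k then 0 else G (kept w C k)) =
      ∑ k ∈ Finset.range (del w C).length, G k := by
  rw [← kept_length w C]
  have : ∀ M ≤ w.length, ∑ k ∈ Finset.range M,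
      (if kept w C (k + 1) = kept w C k then 0 else G (kept w C k)) =
      ∑ k ∈ Finset.range (kept w C M), G k := by
    intro M hM
    induction M with
    | zero => simp [kept_zero]
    | succ M ih =>
      rw [Finset.sum_range_succ, ih (by omega)]
      rcases kept_succ_eq_or w C (show M < w.length from hM) with h | h
      · simp [h, Finset.sum_range_succ]
      · simp [h]
  exact this _ le_rfl

/-- A deleted letter changes no rank of a kept strand, so its term vanishes; the other terms are
reindexed by `sum_kept`. -/
theorem stepSum_interp_one (w : BraidWord) (C : Set ℕ) {j : ℕ} (hj : j ∈ C) (τ : ℝ) :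
    stepSum w.length (interpPos w C 1 j) (interpTime w C 1) τ =
      stepSum (del w C).length (fun k => pos (del w C) k (rank C j)) (fun k => k) τ ∧
    bumpSum w.length (interpPos w C 1 j) (letterSign w) (interpTime w C 1) τ =
      bumpSum (del w C).length (fun k => pos (del w C) k (rank C j)) (letterSign (del w C))
        (fun k => k) τ := by
  have hβ : ∀ k, interpTime w C 1 k = kept w C k := fun k => by rw [interpTime]; ring
  constructor
  · rw [stepSum, stepSum, ← sum_kept, interpPos_one hj, kept_zero]
    congr 1
    refine Finset.sum_congr rfl fun k hk => ?_
    have hk := Finset.mem_range.1 hk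
    rw [interpPos_one hj, interpPos_one hj, hβ]
    rcases kept_succ_eq_or w C hk with h | h <;> simp [h]
  · rw [bumpSum, bumpSum, ← sum_kept]
    refine Finset.sum_congr rfl fun k hk => ?_
    have hk := Finset.mem_range.1 hk
    rw [interpPos_one hj, interpPos_one hj, hβ]
    rcases kept_succ_eq_or w C hk with h | h
    · rw [letterSign_del w C hk (by omega)]; simp [h]
    · simp [h]

theorem exists_rank_eq (C : Set ℕ) {N i : ℕ} (h : i < rank C N) : ∃ j ∈ C, rank C j = i := by
  induction N with
  | zero => simp [rank_zero] at h
  | succ N ih =>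
    by_cases hN : N ∈ C
    · rw [rank_succ_of_mem hN] at h
      rcases Nat.lt_succ_iff_lt_or_eq.1 h with h | h
      · exact ih h
      · exact ⟨N, hN, h.symm⟩
    · rw [rank_succ_of_notMem hN] at h
      exact ih h

theorem interpTime_nonneg {w : BraidWord} {C : Set ℕ} {v : ℝ} (h0 : 0 ≤ v) (h1 : v ≤ 1) (k : ℕ) :
    0 ≤ interpTime w C v k := by
  have := sub_nonneg.2 h1
  unfold interpTime
  positivity

theorem length_del_le (w : BraidWord) (C : Set ℕ) : (del w C).length ≤ w.length := by
  induction w generalizing C with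
  | nil => simp [del]
  | cons x w ih =>
    rw [del]
    split_ifs
    · simpa using ih _
    · exact (ih _).trans (by simp)

/-- As soon as `v > 0`, a deleted letter has less than a unit of time of its own. This is harmless
only if it moves nothing, which is why positions are straightened before times are contracted. -/
theorem interpTime_add_one_le {w : BraidWord} {C : Set ℕ} {v : ℝ} (h0 : 0 ≤ v) (h1 : v ≤ 1)
    {k k' : ℕ} (hk : v = 0 ∨ kept w C (k + 1) = kept w C k + 1) (hkk : k < k') :
    interpTime w C v k + 1 ≤ interpTime w C v k' := by
  have a : (k : ℝ) + 1 ≤ k' := by exact_mod_cast hkk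
  have := mul_le_mul_of_nonneg_left a (sub_nonneg.2 h1)
  unfold interpTime
  rcases hk with rfl | hk
  · linarith
  · have b : (kept w C k : ℝ) + 1 ≤ kept w C k' := by
      exact_mod_cast hk ▸ kept_mono w C (show k + 1 ≤ k' from hkk)
    have := mul_le_mul_of_nonneg_left b h0
    linarith

theorem interpPos_succ_of_kept {w : BraidWord} {C : Set ℕ} {j k : ℕ} (hj : j ∈ C)
    (h : kept w C (k + 1) = kept w C k) : interpPos w C 1 j (k + 1) = interpPos w C 1 j k := by
  rw [interpPos_one hj, interpPos_one hj, h]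

/-- The component of the closure of `w` formed by the strands in a cycle `C` of its permutation
is isotopic to the closure of the word obtained by deleting all other strands. -/
theorem knotIsotopic_del (w : BraidWord) {C : Set ℕ} {i₀ N : ℕ}
    (hC : C = {j | (perm w).SameCycle i₀ j}) (hN : ∀ j ∈ C, j < N) :
    KnotIsotopic (closureOf w C) (closedBraid (rank C N) (del w C)) := by
  have hS : ContDiff ℝ ∞ Real.smoothTransition := Real.smoothTransition.contDiff
  have hpC : ∀ j, perm w j ∈ C ↔ j ∈ C := fun j => by
    simp only [hC, Set.mem_ofPred_eq]; exact Equiv.Perm.sameCycle_apply_right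
  have hpush : push w C = C := by
    ext j
    rw [push, Set.mem_ofPred_eq, ← hpC ((perm w)⁻¹ j)]; simp
  -- The strands in the order in which the component runs through them; `n` below is the length of
  -- this cycle, finite because `C` is bounded.
  set a : ℤ → ℕ := fun m => (perm w ^ m) i₀ with ha
  have haC : ∀ m, a m ∈ C := fun m => by
    rw [hC]; exact ⟨m, rfl⟩
  have hasucc : ∀ m, a (m + 1) = perm w (a m) := fun m => by
    simp only [ha, add_comm m 1, zpow_add, zpow_one, Equiv.Perm.mul_apply]
  have hsurj : ∀ j ∈ C, ∃ m, a m = j := fun j hj => by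
    rw [hC] at hj; exact hj
  obtain ⟨n, hn⟩ : ∃ n : ℕ, n = Function.minimalPeriod (perm w • · : ℕ → ℕ) i₀ := ⟨_, rfl⟩
  have haeq : ∀ m m', a m = a m' ↔ (n : ℤ) ∣ m - m' := fun m m' => by
    rw [hn, ← MulAction.zpow_smul_eq_iff_minimalPeriod_dvd]
    simp only [ha, Equiv.Perm.smul_def]
    rw [show m = m' + (m - m') by ring, zpow_add, Equiv.Perm.mul_apply, add_sub_cancel_left]
    exact (perm w ^ m').injective.eq_iff
  have hn0 : 0 < n := by
    by_contra h
    have h : n = 0 := by omega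
    have hinj : Function.Injective a := fun m m' hm => by
      have := (haeq m m').1 hm
      rw [h] at this
      simpa [sub_eq_zero] using this
    exact Set.infinite_range_of_injective hinj
      ((Set.finite_Iio N).subset (by rintro _ ⟨m, rfl⟩; exact hN _ (haC m)))
  have hanper : ∀ m, a (m + n) = a m := fun m => (haeq _ _).2 (by simp)
  -- Two stages: `U` moves positions during the first half, `V` moves times during the second, so
  -- always `V t = 0` or `U t = 1`.
  set U : ℝ → ℝ := fun t => Real.smoothTransition (2 * t)
  set V : ℝ → ℝ := fun t => Real.smoothTransition (2 * t - 1)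
  have hU0 : ∀ t, 0 ≤ U t := fun t => Real.smoothTransition.nonneg _
  have hU1 : ∀ t, U t ≤ 1 := fun t => Real.smoothTransition.le_one _
  have hV0 : ∀ t, 0 ≤ V t := fun t => Real.smoothTransition.nonneg _
  have hV1 : ∀ t, V t ≤ 1 := fun t => Real.smoothTransition.le_one _
  have hUV : ∀ t, V t = 0 ∨ U t = 1 := fun t => by
    rcases le_total (2 * t) 1 with h | h
    · exact Or.inl (Real.smoothTransition.zero_of_nonpos (by linarith))
    · exact Or.inr (Real.smoothTransition.one_of_one_le h)
  have hUs : ContDiff ℝ ∞ U := hS.comp (contDiff_const.mul contDiff_id)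
  have hVs : ContDiff ℝ ∞ V := hS.comp ((contDiff_const.mul contDiff_id).sub contDiff_const)
  have hU0' : U 0 = 0 := Real.smoothTransition.zero_of_nonpos (by norm_num)
  have hV0' : V 0 = 0 := Real.smoothTransition.zero_of_nonpos (by norm_num)
  have hU1' : U 1 = 1 := Real.smoothTransition.one_of_one_le (by norm_num)
  have hV1' : V 1 = 1 := Real.smoothTransition.one_of_one_le (by norm_num)
  set X : ℤ → ℝ × ℝ → ℝ := fun m y => stepSum w.length (interpPos w C (U y.1) (a m))
    (interpTime w C (V y.1)) (interpPeriod w C (V y.1) * y.2) with hXdef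
  set Z : ℤ → ℝ × ℝ → ℝ := fun m y => bumpSum w.length (interpPos w C (U y.1) (a m))
    (letterSign w) (interpTime w C (V y.1)) (interpPeriod w C (V y.1) * y.2) with hZdef
  have hUs' : ContDiff ℝ ∞ (fun y : ℝ × ℝ => U y.1) := hUs.comp contDiff_fst
  have hVs' : ContDiff ℝ ∞ (fun y : ℝ × ℝ => V y.1) := hVs.comp contDiff_fst
  have hps : ∀ j k, ContDiff ℝ ∞ (fun y : ℝ × ℝ => interpPos w C (U y.1) j k) := fun j k =>
    ((contDiff_const.sub hUs').mul contDiff_const).add (hUs'.mul contDiff_const)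
  have hts : ∀ k, ContDiff ℝ ∞ (fun y : ℝ × ℝ => interpTime w C (V y.1) k) := fun k =>
    ((contDiff_const.sub hVs').mul contDiff_const).add (hVs'.mul contDiff_const)
  have hper : ContDiff ℝ ∞ (fun y : ℝ × ℝ => interpPeriod w C (V y.1)) :=
    ((contDiff_const.sub hVs').mul contDiff_const).add (hVs'.mul contDiff_const)
  have hSs : ∀ k, ContDiff ℝ ∞ (fun y : ℝ × ℝ => Real.smoothTransition
      (interpPeriod w C (V y.1) * y.2 - interpTime w C (V y.1) k)) := fun k =>
    hS.comp ((hper.mul contDiff_snd).sub (hts k))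
  have hX : ∀ m, ContDiff ℝ ∞ (X m) := fun m =>
    (hps _ _).add (ContDiff.sum fun k _ => ((hps _ _).sub (hps _ _)).mul (hSs k))
  have hZ : ∀ m, ContDiff ℝ ∞ (Z m) := fun m =>
    ContDiff.sum fun k _ => (contDiff_const.mul ((hps _ _).sub (hps _ _))).mul
      ((hSs k).mul (contDiff_const.sub (hSs k)))
  -- Each revolution ends with one unit of rest. Its total duration is at most `w.length + 1`, so
  -- the rest takes up at least the fraction `δ`.
  set δ : ℝ := 1 / (w.length + 1) with hδdef
  have hL : (0 : ℝ) < w.length + 1 := by positivity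
  have hδ : 0 < δ := by positivity
  have hδ' : δ ≤ 1 := (div_le_one hL).2 (by linarith [Nat.cast_nonneg (α := ℝ) w.length])
  have hα : ∀ t, 0 ≤ interpPeriod w C (V t) := fun t => by
    have := sub_nonneg.2 (hV1 t)
    have := hV0 t
    unfold interpPeriod
    positivity
  have hαδ : ∀ t, interpPeriod w C (V t) * δ ≤ 1 := fun t => by
    rw [hδdef, mul_one_div, div_le_one hL, interpPeriod]
    have : ((del w C).length : ℝ) ≤ w.length := by exact_mod_cast length_del_le w C
    nlinarith [hV0 t]
  -- Letters without a full unit of time occur only for `V t ≠ 0`; then `U t = 1`, and they move no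
  -- strand of `C`.
  have hidle : ∀ t m k, k < w.length → ¬ (V t = 0 ∨ kept w C (k + 1) = kept w C k + 1) →
      interpPos w C (U t) (a m) (k + 1) = interpPos w C (U t) (a m) k := by
    intro t m k hk h
    push Not at h
    rw [(hUV t).resolve_left h.1]
    exact interpPos_succ_of_kept (haC m) ((kept_succ_eq_or w C hk).resolve_left h.2)
  have hend : ∀ m t T, 1 - δ ≤ T →
      X m (t, T) = interpPos w C (U t) (a m) w.length ∧ Z m (t, T) = 0 := by
    intro m t T hT
    refine stepSum_eq_end (fun k hk => ?_) _
    by_cases h : V t = 0 ∨ kept w C (k + 1) = kept w C k + 1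
    · right
      have h1 := interpTime_add_one_le (hV0 t) (hV1 t) h hk
      have h2 : interpTime w C (V t) w.length = interpPeriod w C (V t) - 1 := by
        rw [interpTime, interpPeriod, kept_length]; ring
      have h3 := mul_le_mul_of_nonneg_left hT (hα t)
      have h4 := hαδ t
      simp only
      linarith
    · exact Or.inl (hidle t m k hk h)
  have hstart : ∀ m t T, T ≤ 0 →
      X m (t, T) = interpPos w C (U t) (a m) 0 ∧ Z m (t, T) = 0 := by
    intro m t T hT
    refine stepSum_eq_start (fun k _ => ?_) _
    exact (mul_nonpos_of_nonneg_of_nonpos (hα t) hT).trans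
      (interpTime_nonneg (hV0 t) (hV1 t) k)
  have hjoin : ∀ m t, interpPos w C (U t) (a m) w.length = interpPos w C (U t) (a (m + 1)) 0 := by
    intro m t
    simp only [interpPos, pos_length, pos_zero, List.take_length, List.take_zero, push_nil, hpush,
      hasucc]
  have hcur := fun t T => exists_current_step w.length
    (fun k => V t = 0 ∨ kept w C (k + 1) = kept w C k + 1) (letterSign w) (interpTime w C (V t))
    (fun k k' hk _ h _ => interpTime_add_one_le (hV0 t) (hV1 t) h hk)
    (interpPeriod w C (V t) * T)
  have key := knotIsotopic_arcsUnion hn0 hX hZ hδ hδ'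
    (fun m t T h1 h2 => by rw [(hend m t T h1).1, (hstart _ t _ (by linarith)).1, hjoin])
    (fun m t T h1 h2 => by rw [(hend m t T h1).2, (hstart _ t _ (by linarith)).2])
    (fun m => by simp only [hXdef, hanper]) (fun m => by simp only [hZdef, hanper])
    (by
      rintro m ⟨t, T⟩
      obtain ⟨K, c, h0, h1, -, H⟩ := hcur t T
      have hx : X m (t, T) = _ := (H _ (hidle t m)).1
      rw [hx]
      have p1 := interpPos_nonneg (w := w) (C := C) (hU0 t) (hU1 t) (a m) K
      have p2 := interpPos_nonneg (w := w) (C := C) (hU0 t) (hU1 t) (a m) (K + 1)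
      nlinarith [mul_nonneg p1 (sub_nonneg.2 h1), mul_nonneg p2 h0])
    (by
      rintro ⟨t, T⟩ m m' hx hz
      obtain ⟨K, c, h0, h1, hK, H⟩ := hcur t T
      have e := H _ (hidle t m)
      have e' := H _ (hidle t m')
      rw [← haeq]
      exact interpPos_separated (hU0 t) (hU1 t) h0 h1 hK (haC m) (haC m')
        (e.1.symm.trans (hx.trans e'.1)) (e.2.symm.trans (hz.trans e'.2)))
  have hK0 : arcsUnion X Z 0 = closureOf w C := by
    rw [closureOf_eq w C fun j hj => (hpC j).2 hj]
    have e1 : interpTime w C 0 = fun k : ℕ => (k : ℝ) := by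
      funext k; rw [interpTime]; ring
    have e2 : interpPeriod w C 0 = w.length + 1 := by rw [interpPeriod]; ring
    have e3 : ∀ j, interpPos w C 0 j = fun k => (pos w k j : ℝ) := fun j =>
      funext fun k => interpPos_zero w C j k
    ext P
    simp only [arcsUnion, hXdef, hZdef, hU0', hV0', e1, e2, e3, Set.mem_ofPred_eq]
    constructor
    · rintro ⟨m, h⟩
      exact ⟨a m, haC m, h⟩
    · rintro ⟨j, hj, h⟩
      obtain ⟨m, rfl⟩ := hsurj j hj
      exact ⟨m, h⟩
  have hrank : ∀ j ∈ C, rank C j < rank C N := fun j hj => rank_lt_rank hj (hN j hj)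
  have hK1 : arcsUnion X Z 1 = closedBraid (rank C N) (del w C) := by
    rw [closedBraid, closureOf_eq (del w C) _ fun i hi => by
      obtain ⟨j, hj, rfl⟩ := exists_rank_eq C hi
      rw [perm_del_rank w C hj, hpush]
      exact hrank _ ((hpC j).2 hj)]
    have e2 : interpPeriod w C 1 = (del w C).length + 1 := by rw [interpPeriod]; ring
    ext P
    simp only [arcsUnion, hXdef, hZdef, hU1', hV1', e2, Set.mem_ofPred_eq,
      (stepSum_interp_one w C (haC _) _).1, (stepSum_interp_one w C (haC _) _).2]
    constructor
    · rintro ⟨m, h⟩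
      exact ⟨rank C (a m), hrank _ (haC m), h⟩
    · rintro ⟨i, hi, h⟩
      obtain ⟨j, hj, rfl⟩ := exists_rank_eq C hi
      obtain ⟨m, rfl⟩ := hsurj j hj
      exact ⟨m, h⟩
  rwa [hK0, hK1] at key

/-! ### Sweeps and full twists -/

theorem sweep_add_two (n : ℕ) : sweep (n + 2) = sweep (n + 1) ++ [(n, 1)] := by
  simp [sweep, List.range_succ]

theorem sweepInv_add_two (n : ℕ) : sweepInv (n + 2) = (n, -1) :: sweepInv (n + 1) := by
  simp [sweepInv, List.range_succ]

theorem perm_sweep_apply (n j : ℕ) :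
    perm (sweep (n + 1)) j = if j = 0 then n else if j ≤ n then j - 1 else j := by
  induction n generalizing j with
  | zero => rcases eq_or_ne j 0 with h | h <;> simp [sweep, perm, h]
  | succ n ih =>
    rw [sweep_add_two, perm_append, Equiv.Perm.mul_apply, ih]
    simp only [perm, Equiv.Perm.mul_apply, Equiv.Perm.one_apply, Equiv.swap_apply_def]
    split_ifs <;> omega

theorem perm_sweepInv (n : ℕ) : perm (sweepInv n) = (perm (sweep n))⁻¹ := by
  induction n with
  | zero => simp [sweep, sweepInv, perm]
  | succ n ih =>
    cases n with
    | zero => simp [sweep, sweepInv, perm]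
    | succ n => rw [sweep_add_two, sweepInv_add_two, perm_append, perm, ih]; simp [perm]

theorem wordPow_succ (w : BraidWord) (k : ℕ) : wordPow w (k + 1) = w ++ wordPow w k := by
  simp [wordPow, List.replicate_succ]

theorem wordPow_zero (w : BraidWord) : wordPow w 0 = [] := by simp [wordPow]

theorem perm_wordPow (w : BraidWord) (k : ℕ) : perm (wordPow w k) = perm w ^ k := by
  induction k with
  | zero => simp [wordPow_zero, perm]
  | succ k ih => rw [wordPow_succ, perm_append, ih, pow_succ]

/-- A sweep carries strand `0` to the top and lowers the others by one: it is the rotation by `-1`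
modulo `n`. -/
theorem perm_sweep_pow {n : ℕ} (hn : 0 < n) (k : ℕ) {j : ℕ} (hj : j < n) :
    (perm (sweep n) ^ k) j < n ∧ (((perm (sweep n) ^ k) j : ℕ) : ℤ) ≡ j - k [ZMOD n] := by
  induction k with
  | zero => simpa using hj
  | succ k ih =>
    obtain ⟨n, rfl⟩ : ∃ m, n = m + 1 := ⟨n - 1, by omega⟩
    rw [pow_succ', Equiv.Perm.mul_apply]
    set i := (perm (sweep (n + 1)) ^ k) j
    rw [perm_sweep_apply]
    obtain ⟨h1, h2⟩ := ih
    have h3 := h2.sub_right 1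
    rw [show ((j : ℤ) - k - 1) = j - (k + 1 : ℕ) by push_cast; ring] at h3
    refine ⟨by split_ifs <;> omega, Int.ModEq.trans ?_ h3⟩
    split_ifs with h h'
    · exact (Int.modEq_iff_dvd.2 ⟨-1, by rw [h]; push_cast; ring⟩)
    · rw [Nat.cast_sub (by omega)]; rfl
    · omega

theorem eq_of_modEq_of_lt {n i j : ℕ} (hi : i < n) (hj : j < n) (h : (i : ℤ) ≡ j [ZMOD n]) :
    i = j :=
  Nat.ModEq.eq_of_lt_of_lt (Int.natCast_modEq_iff.1 h) hi hj

theorem perm_sweep_pow_self (n : ℕ) : perm (sweep n) ^ n = 1 := by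
  rcases Nat.eq_zero_or_pos n with rfl | hn
  · simp
  ext j
  rcases lt_or_ge j n with hj | hj
  · obtain ⟨h1, h2⟩ := perm_sweep_pow hn n hj
    exact eq_of_modEq_of_lt h1 hj (h2.trans (Int.modEq_iff_dvd.2 ⟨1, by simp⟩))
  · obtain ⟨m, rfl⟩ : ∃ m, n = m + 1 := ⟨n - 1, by omega⟩
    have : ∀ k : ℕ, (perm (sweep (m + 1)) ^ k) j = j := by
      intro k
      induction k with
      | zero => simp
      | succ k ih =>
        rw [pow_succ, Equiv.Perm.mul_apply, perm_sweep_apply, if_neg (by omega),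
          if_neg (by omega), ih]
    exact this _

/-- The number of sweeps is a multiple of `r`, the order of the rotation, so full twists are pure.
-/
theorem perm_fullTwists (r : ℕ) (s : ℤ) : perm (fullTwists r s) = 1 := by
  unfold fullTwists
  split_ifs
  · rw [perm_wordPow, mul_comm, pow_mul, perm_sweep_pow_self, one_pow]
  · rw [perm_wordPow, perm_sweepInv, mul_comm, pow_mul, inv_pow, perm_sweep_pow_self, inv_one,
      one_pow]

theorem perm_twistedTorusBraid (p q r : ℕ) (s : ℤ) :
    perm (twistedTorusBraid p q r s) = perm (sweep p) ^ q := by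
  rw [twistedTorusBraid, perm_append, perm_fullTwists, perm_wordPow, one_mul]

theorem perm_sweep_zpow {n : ℕ} (hn : 0 < n) (k : ℤ) {j : ℕ} (hj : j < n) :
    (perm (sweep n) ^ k) j < n ∧ (((perm (sweep n) ^ k) j : ℕ) : ℤ) ≡ j - k [ZMOD n] := by
  have hn' : (n : ℤ) ≠ 0 := by omega
  obtain ⟨m, hm⟩ := Int.eq_ofNat_of_zero_le (Int.emod_nonneg k hn')
  have : perm (sweep n) ^ k = perm (sweep n) ^ m := by
    rw [← Int.emod_add_mul_ediv k n, zpow_add, zpow_mul, zpow_natCast (perm (sweep n)) n,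
      perm_sweep_pow_self, one_zpow, mul_one, hm, zpow_natCast]
  rw [this]
  obtain ⟨h1, h2⟩ := perm_sweep_pow hn m hj
  refine ⟨h1, h2.trans (Int.ModEq.sub_left _ ?_)⟩
  rw [← hm]
  exact Int.mod_modEq k n

/-! ### The components of a twisted torus link -/

/-- The strands congruent to `c` modulo `g`. -/
def residueClass (p g c : ℕ) : Set ℕ := {j | j < p ∧ j % g = c}

theorem sameCycle_twistedTorusBraid {p : ℕ} (hp : 0 < p) (q r : ℕ) (s : ℤ) {i : ℕ} (hi : i < p) :
    {j | (perm (twistedTorusBraid p q r s)).SameCycle i j} =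
      residueClass p (Nat.gcd p q) (i % Nat.gcd p q) := by
  rw [perm_twistedTorusBraid]
  ext j
  have hz : ∀ m : ℤ, (perm (sweep p) ^ q) ^ m = perm (sweep p) ^ ((q : ℤ) * m) := fun m => by
    rw [zpow_mul, zpow_natCast]
  simp only [residueClass, Set.mem_ofPred_eq, Equiv.Perm.SameCycle, hz]
  have hgp : ((Nat.gcd p q : ℕ) : ℤ) ∣ p := Int.natCast_dvd_natCast.2 (Nat.gcd_dvd_left p q)
  have hgq : ((Nat.gcd p q : ℕ) : ℤ) ∣ q := Int.natCast_dvd_natCast.2 (Nat.gcd_dvd_right p q)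
  constructor
  · rintro ⟨m, rfl⟩
    obtain ⟨h1, h2⟩ := perm_sweep_zpow hp (q * m) hi
    refine ⟨h1, Int.natCast_modEq_iff.1 ((h2.of_dvd hgp).trans ?_)⟩
    exact Int.modEq_iff_dvd.2 (by simpa using hgq.mul_right m)
  · rintro ⟨hj, h⟩
    have h : (j : ℤ) ≡ i [ZMOD (Nat.gcd p q : ℕ)] := Int.natCast_modEq_iff.2 h
    obtain ⟨d, hd⟩ := Int.modEq_iff_dvd.1 h
    -- By Bézout, `i - j = (p * gcdA + q * gcdB) * d`; modulo `p` only the multiple of `q` remains.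
    refine ⟨Nat.gcdB p q * d, ?_⟩
    obtain ⟨h1, h2⟩ := perm_sweep_zpow hp (q * (Nat.gcdB p q * d)) hi
    refine eq_of_modEq_of_lt h1 hj (h2.trans (Int.modEq_iff_dvd.2 ⟨-Nat.gcdA p q * d, ?_⟩))
    rw [Nat.gcd_eq_gcd_ab] at hd
    linear_combination -hd

theorem components_twistedTorusBraid {p : ℕ} (hp : 0 < p) (q r : ℕ) (s : ℤ) :
    components p (twistedTorusBraid p q r s) =
      residueClass p (Nat.gcd p q) '' Set.Iio (Nat.gcd p q) := by
  have hg : 0 < Nat.gcd p q := Nat.gcd_pos_of_pos_left q hp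
  have hgp : Nat.gcd p q ≤ p := Nat.gcd_le_left q hp
  ext C
  constructor
  · rintro ⟨i, hi, rfl⟩
    exact ⟨_, Nat.mod_lt i hg, (sameCycle_twistedTorusBraid hp q r s hi).symm⟩
  · rintro ⟨c, hc, rfl⟩
    have hc : c < Nat.gcd p q := hc
    refine ⟨c, by omega, ?_⟩
    rw [sameCycle_twistedTorusBraid hp q r s (by omega), Nat.mod_eq_of_lt hc]

theorem ncard_components_twistedTorusBraid {p : ℕ} (hp : 0 < p) (q r : ℕ) (s : ℤ) :
    (components p (twistedTorusBraid p q r s)).ncard = Nat.gcd p q := by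
  have hgp : Nat.gcd p q ≤ p := Nat.gcd_le_left q hp
  rw [components_twistedTorusBraid hp, Set.InjOn.ncard_image]
  · rw [← Finset.coe_Iio, Set.ncard_coe_finset, Nat.card_Iio]
  · intro c hc d hd h
    have hc : c < Nat.gcd p q := hc
    have : c ∈ residueClass p (Nat.gcd p q) c := ⟨by omega, Nat.mod_eq_of_lt hc⟩
    rw [h] at this
    exact (Nat.mod_eq_of_lt hc).symm.trans this.2

/-! ### Deleting strands from sweeps and full twists -/

theorem rank_push {w : BraidWord} (C : Set ℕ) {n : ℕ} (h : ∀ x ∈ w, x.1 + 2 ≤ n) :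
    rank (push w C) n = rank C n := by
  induction w generalizing C with
  | nil => rw [push_nil]
  | cons x w ih =>
    rw [show x :: w = [x] ++ w from rfl, push_append, ih _ fun y hy => h y (by simp [hy]),
      rank_push_of_ge (h x (by simp))]

theorem add_two_le_of_mem_sweep {n : ℕ} {x : ℕ × ℤˣ} (h : x ∈ sweep n) : x.1 + 2 ≤ n := by
  simp only [sweep, List.mem_map, List.mem_range] at h
  obtain ⟨i, hi, rfl⟩ := h
  simp only
  omega

theorem add_two_le_of_mem_sweepInv {n : ℕ} {x : ℕ × ℤˣ} (h : x ∈ sweepInv n) : x.1 + 2 ≤ n := by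
  simp only [sweepInv, List.mem_reverse, List.mem_map, List.mem_range] at h
  obtain ⟨i, hi, rfl⟩ := h
  simp only
  omega

theorem mem_push_perm_apply {w : BraidWord} {C : Set ℕ} {i j : ℕ} (h : perm w i = j) :
    j ∈ push w C ↔ i ∈ C := by
  rw [← h, perm_mem_push]

/-- All crossings of a sweep involve strand `0`. If it is kept, the surviving crossings are those
with the other kept strands. -/
theorem del_sweep_of_mem {C : Set ℕ} (h0 : 0 ∈ C) (n : ℕ) :
    del (sweep n) C = sweep (rank C n) := by
  induction n with
  | zero => simp [sweep, del, rank_zero]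
  | succ n ih =>
    cases n with
    | zero => simp [sweep, del, rank_succ_of_mem h0, rank_zero]
    | succ n =>
      rw [sweep_add_two, del_append, ih]
      have h1 : n ∈ push (sweep (n + 1)) C :=
        (mem_push_perm_apply (by simp [perm_sweep_apply])).2 h0
      have h2 : n + 1 ∈ push (sweep (n + 1)) C ↔ n + 1 ∈ C :=
        mem_push_perm_apply (by simp [perm_sweep_apply])
      have h3 := rank_push C (w := sweep (n + 1)) (n := n + 1) fun x => add_two_le_of_mem_sweep
      rw [rank_succ_of_mem h1] at h3
      by_cases h : n + 1 ∈ C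
      · rw [rank_succ_of_mem h, ← h3, sweep_add_two, del, if_pos ⟨h1, h2.2 h⟩, del]
      · rw [rank_succ_of_notMem h, del, if_neg fun h' => h (h2.1 h'.2), del, List.append_nil]

theorem del_sweep_of_notMem {C : Set ℕ} (h0 : 0 ∉ C) (n : ℕ) : del (sweep n) C = [] := by
  induction n with
  | zero => simp [sweep, del]
  | succ n ih =>
    cases n with
    | zero => simp [sweep, del]
    | succ n =>
      have h1 : n ∈ push (sweep (n + 1)) C ↔ 0 ∈ C :=
        mem_push_perm_apply (by simp [perm_sweep_apply])
      rw [sweep_add_two, del_append, ih, del, if_neg fun h => h0 (h1.1 h.1), del, List.append_nil]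

/-- In the inverse sweep it is the last strand, `n`, that crosses all the others. -/
theorem del_sweepInv_of_mem {C : Set ℕ} {n : ℕ} (h : n ∈ C) :
    del (sweepInv (n + 1)) C = sweepInv (rank C (n + 1)) := by
  induction n generalizing C with
  | zero => simp [sweepInv, del, rank_succ_of_mem h, rank_zero]
  | succ n ih =>
    rw [sweepInv_add_two, del, rank_succ_of_mem h]
    have h1 : n ∈ push [(n, -1)] C := by rw [mem_push_singleton]; simpa using h
    have h2 : rank (push [(n, -1)] C) (n + 1) = rank C n + 1 := by
      rw [rank_succ_of_mem h1, rank_push_of_le le_rfl]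
    rw [ih h1, h2]
    split_ifs with hn
    · rw [rank_succ_of_mem hn.1, sweepInv_add_two]
    · rw [rank_succ_of_notMem fun h' => hn ⟨h', h⟩]

theorem del_sweepInv_of_notMem {C : Set ℕ} {n : ℕ} (h : n ∉ C) : del (sweepInv (n + 1)) C = [] := by
  induction n generalizing C with
  | zero => simp [sweepInv, del]
  | succ n ih =>
    rw [sweepInv_add_two, del, if_neg fun h' => h h'.2, ih]
    rw [mem_push_singleton]; simpa using h

theorem rank_add (C : Set ℕ) (m n : ℕ) : rank C (m + n) = rank C m + rank {k | m + k ∈ C} n := by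
  induction n with
  | zero => simp [rank_zero]
  | succ n ih =>
    rw [← add_assoc]
    by_cases h : m + n ∈ C
    · rw [rank_succ_of_mem h, rank_succ_of_mem (C := {k | m + k ∈ C}) h, ih, add_assoc]
    · rw [rank_succ_of_notMem h, rank_succ_of_notMem (C := {k | m + k ∈ C}) h, ih]

theorem rank_succ_start_of_mem {C : Set ℕ} (h : 0 ∈ C) (n : ℕ) :
    rank C (n + 1) = rank {k | k + 1 ∈ C} n + 1 := by
  rw [add_comm n 1, rank_add, rank_succ_of_mem h, rank_zero, zero_add, add_comm]
  simp only [add_comm 1]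

theorem rank_succ_start_of_notMem {C : Set ℕ} (h : 0 ∉ C) (n : ℕ) :
    rank C (n + 1) = rank {k | k + 1 ∈ C} n := by
  rw [add_comm n 1, rank_add, rank_succ_of_notMem h, rank_zero, zero_add]
  simp only [add_comm 1]

theorem rank_reflect (C : Set ℕ) (n : ℕ) : rank {k | n - 1 - k ∈ C} n = rank C n := by
  induction n with
  | zero => simp [rank_zero]
  | succ n ih =>
    have e : rank {k | n + 1 - 1 - (k + 1) ∈ C} n = rank {k | n - 1 - k ∈ C} n :=
      rank_congr fun j _ => by
        simp only [Set.mem_ofPred_eq, show n + 1 - 1 - (j + 1) = n - 1 - j by omega]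
    by_cases h : n ∈ C
    · rw [rank_succ_start_of_mem (by simpa using h), rank_succ_of_mem h, ← ih, ← e]; rfl
    · rw [rank_succ_start_of_notMem (by simpa using h), rank_succ_of_notMem h, ← ih, ← e]; rfl

theorem rank_periodic {C : Set ℕ} {n : ℕ} (h : ∀ k, n + k ∈ C ↔ k ∈ C) (m : ℕ) :
    rank C (m * n) = m * rank C n := by
  induction m with
  | zero => simp [rank_zero]
  | succ m ih =>
    rw [add_mul, one_mul, add_comm, rank_add]
    simp only [h, Set.ofPred_mem_eq, ih]
    ring

theorem add_one_mod_cases {n : ℕ} (hn : 0 < n) (k : ℕ) :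
    (k + 1) % n = k % n + 1 ∧ k % n + 1 < n ∨ (k + 1) % n = 0 ∧ k % n = n - 1 := by
  have := Nat.mod_lt k hn
  rw [← Nat.mod_add_mod]
  rcases Nat.lt_or_ge (k % n + 1) n with h | h
  · exact Or.inl ⟨Nat.mod_eq_of_lt h, h⟩
  · have e : k % n + 1 = n := by omega
    exact Or.inr ⟨by rw [e, Nat.mod_self], by omega⟩

/-- Because sweeps rotate the positions, sweep number `k` is performed by the strand starting at `k
% n`, and survives exactly when that strand is kept. -/
theorem del_wordPow_sweep {n : ℕ} (hn : 0 < n) (C : Set ℕ) (m : ℕ) :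
    del (wordPow (sweep n) m) C = wordPow (sweep (rank C n)) (rank {k | k % n ∈ C} m) := by
  induction m generalizing C with
  | zero => simp [wordPow_zero, del, rank_zero]
  | succ m ih =>
    have e : {k | k % n ∈ push (sweep n) C} = {k | k + 1 ∈ {k | k % n ∈ C}} := by
      ext k
      simp only [Set.mem_ofPred_eq]
      refine mem_push_perm_apply ?_
      obtain ⟨n, rfl⟩ : ∃ m, n = m + 1 := ⟨n - 1, by omega⟩
      rw [perm_sweep_apply]
      have := add_one_mod_cases hn k
      split_ifs <;> omega
    rw [wordPow_succ, del_append, ih, rank_push C fun x => add_two_le_of_mem_sweep, e]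
    by_cases h : 0 ∈ C
    · rw [del_sweep_of_mem h, rank_succ_start_of_mem (by simpa using h), wordPow_succ]
    · rw [del_sweep_of_notMem h, rank_succ_start_of_notMem (by simpa using h), List.nil_append]

/-- Inverse sweeps are performed by the strands in decreasing order, number `k` by the strand `n - 1
- k % n`. -/
theorem del_wordPow_sweepInv {n : ℕ} (hn : 0 < n) (C : Set ℕ) (m : ℕ) :
    del (wordPow (sweepInv n) m) C =
      wordPow (sweepInv (rank C n)) (rank {k | n - 1 - k % n ∈ C} m) := by
  induction m generalizing C with
  | zero => simp [wordPow_zero, del, rank_zero]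
  | succ m ih =>
    obtain ⟨n, rfl⟩ : ∃ m, n = m + 1 := ⟨n - 1, by omega⟩
    have e : {k | n + 1 - 1 - k % (n + 1) ∈ push (sweepInv (n + 1)) C} =
        {k | k + 1 ∈ {k | n + 1 - 1 - k % (n + 1) ∈ C}} := by
      ext k
      simp only [Set.mem_ofPred_eq]
      refine mem_push_perm_apply ?_
      rw [perm_sweepInv, Equiv.Perm.inv_eq_iff_eq, perm_sweep_apply]
      have := add_one_mod_cases hn k
      split_ifs <;> omega
    rw [wordPow_succ, del_append, ih, rank_push C fun x => add_two_le_of_mem_sweepInv, e]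
    by_cases h : n ∈ C
    · rw [del_sweepInv_of_mem h, rank_succ_start_of_mem (C := {k | n + 1 - 1 - k % (n + 1) ∈ C}) (by simpa using h), wordPow_succ]
    · rw [del_sweepInv_of_notMem h, rank_succ_start_of_notMem (C := {k | n + 1 - 1 - k % (n + 1) ∈ C})
        (by simpa using h), List.nil_append]

/-- Each of the `r` strands performs `|s|` of the sweeps, so `|s| * rank C r` sweeps on `rank C r`
strands survive. -/
theorem del_fullTwists {r : ℕ} (hr : 0 < r) (s : ℤ) (C : Set ℕ) :
    del (fullTwists r s) C = fullTwists (rank C r) s := by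
  have e1 : rank {k | k % r ∈ C} r = rank C r :=
    rank_congr fun j hj => by simp [Nat.mod_eq_of_lt hj]
  have e2 : rank {k | r - 1 - k % r ∈ C} r = rank C r := by
    rw [← rank_reflect C r]
    exact rank_congr fun j hj => by simp [Nat.mod_eq_of_lt hj]
  unfold fullTwists
  split_ifs
  · rw [del_wordPow_sweep hr, rank_periodic (by simp), e1]
  · rw [del_wordPow_sweepInv hr, rank_periodic (by simp), e2]

/-! ### Linking numbers -/

/-- The sum of the signs of the letters. -/
def signSum (w : BraidWord) : ℤ := (w.map fun x => (x.2 : ℤ)).sum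

theorem signSum_nil : signSum [] = 0 := rfl

theorem signSum_cons (x : ℕ × ℤˣ) (w : BraidWord) : signSum (x :: w) = x.2 + signSum w := by
  simp [signSum]

theorem signSum_append (u v : BraidWord) : signSum (u ++ v) = signSum u + signSum v := by
  simp [signSum]

theorem signSum_wordPow (w : BraidWord) (k : ℕ) : signSum (wordPow w k) = k * signSum w := by
  induction k with
  | zero => simp [wordPow_zero, signSum_nil]
  | succ k ih => rw [wordPow_succ, signSum_append, ih]; push_cast; ring

theorem signSum_sweep (n : ℕ) : signSum (sweep (n + 1)) = n := by
  simp [signSum, sweep, Function.comp_def]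

theorem signSum_sweepInv (n : ℕ) : signSum (sweepInv (n + 1)) = -n := by
  simp [signSum, sweepInv, Function.comp_def]

theorem signSum_fullTwists (r : ℕ) (s : ℤ) : signSum (fullTwists r s) = s * (r * (r - 1)) := by
  unfold fullTwists
  cases r with
  | zero => split_ifs <;> simp [wordPow_zero, signSum_nil]
  | succ r =>
    split_ifs with h
    · rw [signSum_wordPow, signSum_sweep]; push_cast; rw [abs_of_nonneg h]; ring
    · rw [signSum_wordPow, signSum_sweepInv]; push_cast; rw [abs_of_neg (by omega)]; ring

theorem signSum_twistedTorusBraid {p : ℕ} (hp : 0 < p) (q r : ℕ) (s : ℤ) :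
    signSum (twistedTorusBraid p q r s) = q * (p - 1) + s * (r * (r - 1)) := by
  obtain ⟨p, rfl⟩ : ∃ m, p = m + 1 := ⟨p - 1, by omega⟩
  rw [twistedTorusBraid, signSum_append, signSum_wordPow, signSum_sweep, signSum_fullTwists]
  push_cast
  ring

theorem isCrossingBetween_iff (w : BraidWord) (C D : Set ℕ) (k i : ℕ) :
    IsCrossingBetween w C D k i ↔
      i ∈ push (w.take k) C ∧ i + 1 ∈ push (w.take k) D ∨
      i ∈ push (w.take k) D ∧ i + 1 ∈ push (w.take k) C := by
  constructor
  · rintro ⟨a, b, rfl, hb, h⟩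
    rw [← hb]
    simpa only [pos_mem_push] using h
  · intro h
    exact ⟨(perm (w.take k))⁻¹ i, (perm (w.take k))⁻¹ (i + 1), by simp [pos], by simp [pos], h⟩

open Classical in
theorem linkingNumber_cons (x : ℕ × ℤˣ) (w : BraidWord) (C D : Set ℕ) :
    linkingNumber (x :: w) C D =
      (if x.1 ∈ C ∧ x.1 + 1 ∈ D ∨ x.1 ∈ D ∧ x.1 + 1 ∈ C then ((x.2 : ℤ) : ℚ) else 0) / 2 +
        linkingNumber w (push [x] C) (push [x] D) := by
  have hp : ∀ (k : ℕ) (C : Set ℕ), push (x :: w.take k) C = push (w.take k) (push [x] C) :=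
    fun k C => push_append [x] _ C
  simp only [linkingNumber, isCrossingBetween_iff]
  rw [← add_div]
  congr 1
  refine (Fin.sum_univ_succ (n := w.length) _).trans ?_
  simp [push_nil, hp]

/-- The linking number in terms of the numbers of crossings of the link and its components. -/
theorem signSum_eq_add_linkingNumber {p : ℕ} {w : BraidWord} {C D : Set ℕ}
    (hw : ∀ x ∈ w, x.1 + 2 ≤ p) (hcover : ∀ j < p, j ∈ C ∨ j ∈ D)
    (hdisj : ∀ j, ¬ (j ∈ C ∧ j ∈ D)) :
    (signSum w : ℚ) = signSum (del w C) + signSum (del w D) + 2 * linkingNumber w C D := by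
  induction w generalizing C D with
  | nil => simp [signSum_nil, del, linkingNumber]
  | cons x w ih =>
    have hx := hw x (by simp)
    have ih' := ih (C := push [x] C) (D := push [x] D) (fun y hy => hw y (by simp [hy]))
      (fun j hj => by
        simp only [mem_push_singleton]
        refine hcover _ ?_
        rw [Equiv.swap_apply_def]; split_ifs <;> omega)
      (fun j => by simp only [mem_push_singleton]; exact hdisj _)
    rw [signSum_cons, linkingNumber_cons, del, del]
    push_cast
    rw [ih']
    have a1 := hcover x.1 (by omega)
    have a2 := hcover (x.1 + 1) (by omega)
    have a3 := hdisj x.1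
    have a4 := hdisj (x.1 + 1)
    -- The letter joins two strands of `C`, two of `D`, or one of each; it is counted once, in the
    -- corresponding term.
    by_cases b1 : x.1 ∈ C <;> by_cases b2 : x.1 + 1 ∈ C <;>
      by_cases b3 : x.1 ∈ D <;> by_cases b4 : x.1 + 1 ∈ D <;>
      first
        | (exfalso; tauto)
        | (simp [b1, b2, b3, b4, signSum_cons]; ring)

/-! ### Two-component twisted torus links -/

theorem del_twistedTorusBraid {p q r g c : ℕ} (s : ℤ) (hp : 0 < p) (hr : 0 < r)
    (hgp : g ∣ p) (hpush : push (wordPow (sweep p) q) (residueClass p g c) = residueClass p g c) :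
    del (twistedTorusBraid p q r s) (residueClass p g c) =
      wordPow (sweep (rank (residueClass p g c) p)) (rank {k | k % g = c} q) ++
        fullTwists (rank (residueClass p g c) r) s := by
  have e : {k | k % p ∈ residueClass p g c} = {k | k % g = c} := by
    ext k
    simp [residueClass, Nat.mod_lt k hp, Nat.mod_mod_of_dvd k hgp]
  rw [twistedTorusBraid, del_append, hpush, del_fullTwists hr, del_wordPow_sweep hp, e]

theorem rank_mod_two (n : ℕ) : rank {k | k % 2 = 0} n = (n + 1) / 2 ∧
    rank {k | k % 2 = 1} n = n / 2 := by
  induction n with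
  | zero => simp [rank_zero]
  | succ n ih =>
    rcases Nat.mod_two_eq_zero_or_one n with h | h
    · rw [rank_succ_of_mem (C := {k | k % 2 = 0}) h,
        rank_succ_of_notMem (C := {k | k % 2 = 1}) (by simp [h])]
      omega
    · rw [rank_succ_of_notMem (C := {k | k % 2 = 0}) (by simp [h]),
        rank_succ_of_mem (C := {k | k % 2 = 1}) h]
      omega

theorem rank_residueClass {p g c i : ℕ} (h : i ≤ p) :
    rank (residueClass p g c) i = rank {k | k % g = c} i :=
  rank_congr fun j hj => by simp [residueClass, show j < p by omega]

theorem rank_mod_two_of_even {n c : ℕ} (hn : 2 ∣ n) (hc : c < 2) :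
    rank {k | k % 2 = c} n = n / 2 := by
  have := rank_mod_two n
  obtain rfl | rfl : c = 0 ∨ c = 1 := by omega
  · rw [this.1]; omega
  · exact this.2

theorem add_two_le_of_mem_fullTwists {r : ℕ} {s : ℤ} {x : ℕ × ℤˣ} (h : x ∈ fullTwists r s) :
    x.1 + 2 ≤ r := by
  unfold fullTwists at h
  split_ifs at h
  · simp only [wordPow, List.mem_flatten, List.mem_replicate] at h
    obtain ⟨l, ⟨-, rfl⟩, h⟩ := h
    exact add_two_le_of_mem_sweep h
  · simp only [wordPow, List.mem_flatten, List.mem_replicate] at h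
    obtain ⟨l, ⟨-, rfl⟩, h⟩ := h
    exact add_two_le_of_mem_sweepInv h

theorem add_two_le_of_mem_twistedTorusBraid {p q r : ℕ} {s : ℤ} (hrp : r ≤ p) {x : ℕ × ℤˣ}
    (h : x ∈ twistedTorusBraid p q r s) : x.1 + 2 ≤ p := by
  rcases List.mem_append.1 h with h | h
  · simp only [wordPow, List.mem_flatten, List.mem_replicate] at h
    obtain ⟨l, ⟨-, rfl⟩, h⟩ := h
    exact add_two_le_of_mem_sweep h
  · exact (add_two_le_of_mem_fullTwists h).trans hrp

section TwoComponents

variable {p q r c : ℕ} (s : ℤ)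

theorem sameCycle_of_gcd_eq_two (hp : 1 < p) (hpq : Nat.gcd p q = 2) (hc : c < 2) :
    residueClass p 2 c = {j | (perm (twistedTorusBraid p q r s)).SameCycle c j} := by
  rw [sameCycle_twistedTorusBraid (by omega) q r s (by omega), hpq, Nat.mod_eq_of_lt hc]

/-- Half of the strands and half of the sweeps survive, so the words agree on the nose and no
further isotopy is needed. -/
theorem del_twistedTorusBraid_of_gcd_eq_two (hp : 1 < p) (hpq : Nat.gcd p q = 2) (hr : 0 < r)
    (hc : c < 2) :
    del (twistedTorusBraid p q r s) (residueClass p 2 c) =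
      twistedTorusBraid (p / 2) (q / 2) (rank (residueClass p 2 c) r) s := by
  have h2p : 2 ∣ p := hpq ▸ Nat.gcd_dvd_left p q
  have h2q : 2 ∣ q := hpq ▸ Nat.gcd_dvd_right p q
  rw [del_twistedTorusBraid s (by omega) hr h2p, rank_residueClass le_rfl,
    rank_mod_two_of_even h2p hc, rank_mod_two_of_even h2q hc, twistedTorusBraid]
  rw [sameCycle_of_gcd_eq_two (r := r) s hp hpq hc]
  -- The torus part has the same permutation as the whole braid, so it preserves the cycle and the
  -- full twists meet the same set of strands.
  ext j
  rw [push, Set.mem_ofPred_eq, Set.mem_ofPred_eq, perm_wordPow, ← perm_twistedTorusBraid p q r s,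
    Set.mem_ofPred_eq, ← Equiv.Perm.sameCycle_apply_right (y := (perm _)⁻¹ j)]
  simp

theorem componentHasType_residueClass (hp : 1 < p) (hpq : Nat.gcd p q = 2) (hr : 0 < r)
    (hc : c < 2) :
    ComponentHasType p q r s (residueClass p 2 c) (p / 2) (q / 2)
      (rank (residueClass p 2 c) r) s := by
  have h2p : 2 ∣ p := hpq ▸ Nat.gcd_dvd_left p q
  have := knotIsotopic_del (twistedTorusBraid p q r s) (N := p)
    (sameCycle_of_gcd_eq_two s hp hpq hc) fun j hj => hj.1
  rwa [del_twistedTorusBraid_of_gcd_eq_two s hp hpq hr hc, rank_residueClass le_rfl,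
    rank_mod_two_of_even h2p hc] at this

/-- Subtracting the sign sums of the two components from that of the link leaves `p * q / 2 + 2 * s
* a * b`, twice the linking number, where `a` and `b` are the two ranks. -/
theorem linkingNumber_residueClass {d : ℕ} (hp : 1 < p) (hpq : Nat.gcd p q = 2) (hr : 0 < r)
    (hrp : r ≤ p) (hc : c < 2) (hd : d < 2) (hcd : c ≠ d) :
    linkingNumber (twistedTorusBraid p q r s) (residueClass p 2 c) (residueClass p 2 d) =
      (p * q : ℚ) / 4 + s * rank (residueClass p 2 c) r * rank (residueClass p 2 d) r := by
  have h := signSum_eq_add_linkingNumber (p := p) (w := twistedTorusBraid p q r s)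
    (C := residueClass p 2 c) (D := residueClass p 2 d)
    (fun x hx => add_two_le_of_mem_twistedTorusBraid hrp hx)
    (fun j hj => by simp only [residueClass, Set.mem_ofPred_eq]; omega)
    (fun j hj => by simp only [residueClass, Set.mem_ofPred_eq] at hj; omega)
  have hsum : rank (residueClass p 2 c) r + rank (residueClass p 2 d) r = r := by
    rw [rank_residueClass hrp, rank_residueClass hrp]
    have := rank_mod_two r
    obtain ⟨rfl, rfl⟩ | ⟨rfl, rfl⟩ : c = 0 ∧ d = 1 ∨ c = 1 ∧ d = 0 := by omega
    · omega
    · omega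
  obtain ⟨p', rfl⟩ : 2 ∣ p := hpq ▸ Nat.gcd_dvd_left p q
  obtain ⟨q', rfl⟩ : 2 ∣ q := hpq ▸ Nat.gcd_dvd_right _ q
  rw [del_twistedTorusBraid_of_gcd_eq_two s hp hpq hr hc,
    del_twistedTorusBraid_of_gcd_eq_two s hp hpq hr hd, signSum_twistedTorusBraid (by omega),
    signSum_twistedTorusBraid (by omega), signSum_twistedTorusBraid (by omega),
    Nat.mul_div_cancel_left _ two_pos, Nat.mul_div_cancel_left _ two_pos] at h
  have hsum' : (rank (residueClass (2 * p') 2 c) r : ℚ) + rank (residueClass (2 * p') 2 d) r = r := by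
    exact_mod_cast hsum
  push_cast at h ⊢
  -- With `a + b = r`, the second coefficient comes from r(r-1) - (a+b)(a+b-1) = (r-(a+b))(r+a+b-1).
  linear_combination -(1 / 2 : ℚ) * h - (1 / 2 : ℚ) * s *
    (r + rank (residueClass (2 * p') 2 c) r + rank (residueClass (2 * p') 2 d) r - 1) * hsum'

end TwoComponents

end TwistedTorus

end

/-! ### The theorem on two-component links with linking number zero -/

theorem mainTheorem7 (p q r : ℕ) (s : ℤ) (hp : 1 < p) (hq : 1 ≤ q)
    (hr : 2 ≤ r) (hrp : r ≤ p) (hs : s ≠ 0) :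
    ((TwistedTorus.components p (TwistedTorus.twistedTorusBraid p q r s)).ncard = 2 ↔
      Nat.gcd p q = 2) ∧
    ∀ C D : Set ℕ, C ≠ D →
      TwistedTorus.components p (TwistedTorus.twistedTorusBraid p q r s) = {C, D} →
      TwistedTorus.linkingNumber (TwistedTorus.twistedTorusBraid p q r s) C D = 0 →
      (Even r →
        (p * q : ℤ) = -(r : ℤ) ^ 2 * s ∧
        TwistedTorus.ComponentHasType p q r s C (p / 2) (q / 2) (r / 2) s ∧
        TwistedTorus.ComponentHasType p q r s D (p / 2) (q / 2) (r / 2) s) ∧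
      (∀ r' : ℕ, r = 2 * r' + 1 →
        (p * q : ℤ) = -4 * (r' : ℤ) * ((r' : ℤ) + 1) * s ∧
        ((TwistedTorus.ComponentHasType p q r s C (p / 2) (q / 2) r' s ∧
          TwistedTorus.ComponentHasType p q r s D (p / 2) (q / 2) (r' + 1) s) ∨
         (TwistedTorus.ComponentHasType p q r s C (p / 2) (q / 2) (r' + 1) s ∧
          TwistedTorus.ComponentHasType p q r s D (p / 2) (q / 2) r' s))) := by
  have hcard := TwistedTorus.ncard_components_twistedTorusBraid (show 0 < p by omega) q r s
  refine ⟨by rw [hcard], fun C D hCD hcomp hlk => ?_⟩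
  have hpq : Nat.gcd p q = 2 := by rw [← hcard, hcomp, Set.ncard_pair hCD]
  rw [TwistedTorus.components_twistedTorusBraid (by omega), hpq] at hcomp
  obtain ⟨c, hc, rfl⟩ : C ∈ TwistedTorus.residueClass p 2 '' Set.Iio 2 := by simp [hcomp]
  obtain ⟨d, hd, rfl⟩ : D ∈ TwistedTorus.residueClass p 2 '' Set.Iio 2 := by simp [hcomp]
  have hc : c < 2 := hc
  have hd : d < 2 := hd
  have hcd : c ≠ d := fun h => hCD (by rw [h])
  have hC := TwistedTorus.componentHasType_residueClass s hp hpq (show 0 < r by omega) hc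
  have hD := TwistedTorus.componentHasType_residueClass s hp hpq (show 0 < r by omega) hd
  rw [TwistedTorus.linkingNumber_residueClass s hp hpq (by omega) hrp hc hd hcd] at hlk
  have hlk' : (p * q : ℤ) = -4 * TwistedTorus.rank (TwistedTorus.residueClass p 2 c) r *
      TwistedTorus.rank (TwistedTorus.residueClass p 2 d) r * s := by
    have : (p * q : ℚ) = -4 * TwistedTorus.rank (TwistedTorus.residueClass p 2 c) r *
        TwistedTorus.rank (TwistedTorus.residueClass p 2 d) r * s := by linear_combination 4 * hlk
    exact_mod_cast this
  rw [TwistedTorus.rank_residueClass hrp] at hC hD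
  rw [TwistedTorus.rank_residueClass hrp, TwistedTorus.rank_residueClass hrp] at hlk'
  have hrk := TwistedTorus.rank_mod_two r
  constructor
  · intro hev
    have h2r : 2 ∣ r := hev.two_dvd
    rw [TwistedTorus.rank_mod_two_of_even h2r hc] at hC hlk'
    rw [TwistedTorus.rank_mod_two_of_even h2r hd] at hD hlk'
    refine ⟨?_, hC, hD⟩
    obtain ⟨m, rfl⟩ := h2r
    rw [Nat.mul_div_cancel_left _ two_pos] at hlk'
    rw [hlk']; push_cast; ring
  · rintro r' rfl
    rw [show (2 * r' + 1 + 1) / 2 = r' + 1 by omega, show (2 * r' + 1) / 2 = r' by omega] at hrk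
    -- The even class contains `r' + 1` of the first `2 * r' + 1` strands, the odd class `r'`;
    -- either may be `C`, whence the disjunction.
    obtain ⟨rfl, rfl⟩ | ⟨rfl, rfl⟩ : c = 0 ∧ d = 1 ∨ c = 1 ∧ d = 0 := by omega
    · rw [hrk.1] at hC hlk'
      rw [hrk.2] at hD hlk'
      exact ⟨by rw [hlk']; push_cast; ring, Or.inr ⟨hC, hD⟩⟩
    · rw [hrk.2] at hC hlk'
      rw [hrk.1] at hD hlk'
      exact ⟨by rw [hlk']; push_cast; ring, Or.inl ⟨hC, hD⟩⟩
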